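/- A \emph{transaction} is a finite sequence of operations, each reading or writing a value $v$ of a variable $x$, such that each variable is written at most once and no read of $x$ is preceded by a write to $x$. A \emph{history} $h=\langle T,\mathsf{so},\mathsf{wr}\rangle$ consists of a finite set $T$ of transactions, a strict partial order $\mathsf{so}$ on $T$ (the session order) and a relation $\mathsf{wr}$ relating to each read operation exactly one transaction, such that a read of value $v$ from $x$ is related to a transaction that writes $v$ to $x$, and $\mathsf{so}\cup\mathsf{wr}$ is acyclic on $T$ (where $(t_1,t_2)\in\mathsf{wr}$, resp. $\mathsf{wr}_x$, if some read in $t_2$, resp. some read of $x$ in $t_2$, is related to $t_1$). Moreover some transaction $\mathsf{so}$-precedes all the others and writes all the variables occurring in $h$. The history is \emph{serializable} if there is a strict total order $\mathsf{co}\supseteq\mathsf{so}\cup\mathsf{wr}$ on $T$ such that, for all $x$ and all $t_1\neq t_2$ and $t_3$ in $T$, if $(t_1,t_3)\in\mathsf{wr}_x$, $t_2$ writes $x$ and $(t_2,t_3)\in\mathsf{co}$, then $(t_2,t_1)\in\mathsf{co}$. Let $\mathsf{size}(h)=|T|$, let $\mathsf{width}(h)$ be the maximal number of pairwise $\mathsf{so}$-incomparable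 transactions, and let $N(h)$ be the length of the input that describes $h$ (a list of natural numbers: the number of transactions, the matrix of $\mathsf{so}$, and for each transaction its number of operations and, for each operation, its kind, variable, value and the transaction that it reads from, if any). There is an algorithm (a program for a random access machine whose arithmetic is addition and truncated subtraction) that decides, for every history $h$, whether $h$ is serializable, such that the following hold. 1. Counting each elementary instruction and each test as one step, its running time is $$O\bigl(\mathsf{size}(h)^{\mathsf{width}(h)}\cdot\mathsf{size}(h)^3+\mathsf{size}(h)\cdot N(h)\bigr)$$ with an absolute constant; in particular it is $O(\mathsf{size}(h)^{\mathsf{width}(h)}\cdot\mathsf{size}(h)^3)$ for histories with $N(h)=O(\mathsf{size}(h)^{\mathsf{width}(h)+2})$. 2. For every fixed $k\in\mathbb{N}$, on the histories of width at most $k$ its running time is polynomial in the number of bits of the input, even in the logarithmic cost model (where each step costs the number of bits of its operands and addresses). Hence, for every fixed $k$, checking serializability of histories of width at most $k$ takes polynomial time. -/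

import Mathlib

/-! ### Histories of transactions -/

/-- Read and write operations; variables and values are named by natural numbers. -/
inductive Op where
  | read (x v : ℕ)
  | write (x v : ℕ)

/-- The data of a history. A transaction is the list of its operations in program order, so that
an operation is identified by its transaction and its position in it. The write-read relation is
given through its inverse, which sends each read to the transaction it reads from. -/
structure RawHistory where
  /-- number of transactions -/
  size : ℕ
  /-- operations of each transaction, in program order -/
  ops : Fin size → List Op
  /-- session order -/
  so : Fin size → Fin size → Bool
  /-- `src t i = some t'` iff the `i`-th operation of `t` reads from `t'` -/
  src : (t : Fin size) → Fin (ops t).length → Option (Fin size)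

namespace RawHistory

variable (h : RawHistory)

/-- `t` writes the variable `x`. -/
def Writes (t : Fin h.size) (x : ℕ) : Prop :=
  ∃ v, Op.write x v ∈ h.ops t

/-- `x` occurs in some operation of `t`. -/
def Mentions (t : Fin h.size) (x : ℕ) : Prop :=
  ∃ v, Op.read x v ∈ h.ops t ∨ Op.write x v ∈ h.ops t

/-- The write-read relation between transactions, restricted to reads of `x`. -/
def wrOn (x : ℕ) (t₁ t₂ : Fin h.size) : Prop :=
  ∃ i v, (h.ops t₂).get i = Op.read x v ∧ h.src t₂ i = some t₁

/-- The write-read relation between transactions. -/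
def wr (t₁ t₂ : Fin h.size) : Prop :=
  ∃ x, h.wrOn x t₁ t₂

end RawHistory

/-- A history. -/
structure History extends RawHistory where
  /-- a transaction writes each variable at most once -/
  write_unique : ∀ t i j x v v', (ops t).get i = Op.write x v → (ops t).get j = Op.write x v' → i = j
  /-- in a transaction, no read of a variable is preceded by a write to that variable -/
  read_first : ∀ t i j x v v', (ops t).get i = Op.read x v → (ops t).get j = Op.write x v' → i < j
  /-- the session order is a strict partial order -/
  so_irrefl : ∀ t, so t t = false
  so_trans : ∀ t₁ t₂ t₃, so t₁ t₂ = true → so t₂ t₃ = true → so t₁ t₃ = true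
  /-- each read reads from a transaction which writes the value read to the variable read -/
  src_read : ∀ t i x v, (ops t).get i = Op.read x v →
    ∃ t', src t i = some t' ∧ Op.write x v ∈ ops t'
  /-- only reads are in the write-read relation -/
  src_write : ∀ t i x v, (ops t).get i = Op.write x v → src t i = none
  /-- the union of the session order and the write-read relation is acyclic -/
  acyclic : ∀ t, ¬ Relation.TransGen
    (fun a b => so a b = true ∨ toRawHistory.wr a b) t t
  /-- some transaction precedes all the others and writes (initial values to) all the variables -/
  init : ∃ t₀, (∀ t, t ≠ t₀ → so t₀ t = true) ∧
    ∀ t x, toRawHistory.Mentions t x → toRawHistory.Writes t₀ x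

namespace History

/-- Some strict total order `co` (a commit order) extends the session order and the write-read
relation, and a transaction `t₂` that writes `x` and commits before a transaction `t₃` which
reads `x` from `t₁ ≠ t₂` commits before `t₁`. -/
def Serializable (h : History) : Prop :=
  ∃ co : Fin h.size → Fin h.size → Prop, IsStrictTotalOrder (Fin h.size) co ∧
    (∀ t₁ t₂, h.so t₁ t₂ = true → co t₁ t₂) ∧
    (∀ t₁ t₂, h.wr t₁ t₂ → co t₁ t₂) ∧
    ∀ x t₁ t₂ t₃, t₁ ≠ t₂ → h.wrOn x t₁ t₃ → h.Writes t₂ x → co t₂ t₃ → co t₂ t₁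

open Classical in
/-- The maximal number of transactions that are pairwise unordered by the session order. -/
noncomputable def width (h : History) : ℕ :=
  (Finset.univ.filter fun s : Finset (Fin h.size) =>
    IsAntichain (fun a b => h.so a b = true) (s : Set (Fin h.size))).sup Finset.card

/-- An operation as four numbers: its kind, its variable, its value, and one plus the index of the
transaction it reads from (zero for a write). -/
def encodeOp (h : History) (t : Fin h.size) (i : Fin (h.ops t).length) : List ℕ :=
  let s : ℕ := (h.src t i).elim 0 fun t' => t'.val + 1
  match (h.ops t).get i with
  | Op.read x v => [0, x, v, s]
  | Op.write x v => [1, x, v, s]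

/-- A history as a list of numbers: the number of transactions, the matrix of the session order,
and for each transaction the number of its operations followed by these operations. -/
def encode (h : History) : List ℕ :=
  h.size ::
    (((List.finRange h.size).flatMap fun a => (List.finRange h.size).map fun b => (h.so a b).toNat)
      ++ (List.finRange h.size).flatMap fun t =>
        (h.ops t).length :: (List.finRange (h.ops t).length).flatMap (h.encodeOp t))

end History

/-! ### Random access machines -/

/-- The memory of the machine: registers and arrays of natural numbers. A program mentions only
finitely many registers and arrays; each array is unbounded. -/
structure RamState where
  reg : ℕ → ℕ
  arr : ℕ → ℕ → ℕ

/-- Elementary instructions. There is no multiplication. -/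
inductive Instr where
  /-- `reg x := c` -/
  | const (x c : ℕ)
  /-- `reg x := reg y + reg z` -/
  | add (x y z : ℕ)
  /-- `reg x := reg y - reg z`, truncated at zero -/
  | sub (x y z : ℕ)
  /-- `reg x := arr a [reg y]` -/
  | load (x a y : ℕ)
  /-- `arr a [reg x] := reg y` -/
  | store (a x y : ℕ)

namespace Instr

/-- The effect of an instruction. -/
def run (s : RamState) : Instr → RamState
  | const x c => { s with reg := Function.update s.reg x c }
  | add x y z => { s with reg := Function.update s.reg x (s.reg y + s.reg z) }
  | sub x y z => { s with reg := Function.update s.reg x (s.reg y - s.reg z) }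
  | load x a y => { s with reg := Function.update s.reg x (s.arr a (s.reg y)) }
  | store a x y =>
    { s with arr := Function.update s.arr a (Function.update (s.arr a) (s.reg x) (s.reg y)) }

/-- The logarithmic cost of an instruction: one plus the number of bits of the operands, including
addresses. -/
def bitCost (s : RamState) : Instr → ℕ
  | const _ c => 1 + c.size
  | add _ y z => 1 + (s.reg y).size + (s.reg z).size
  | sub _ y z => 1 + (s.reg y).size + (s.reg z).size
  | load _ a y => 1 + (s.reg y).size + (s.arr a (s.reg y)).size
  | store _ x y => 1 + (s.reg x).size + (s.reg y).size

end Instr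

/-- Programs: sequences, branches and loops over elementary instructions. -/
inductive Prog where
  | instr (i : Instr)
  | seq (p q : Prog)
  /-- if `reg x ≠ 0` then `p` else `q` -/
  | ite (x : ℕ) (p q : Prog)
  /-- while `reg x ≠ 0` do `p` -/
  | loop (x : ℕ) (p : Prog)

/-- `Exec p s t b s'`: started in `s`, the program `p` halts in `s'` after `t` steps (elementary
instructions and tests, each counted once) of total logarithmic cost `b`. -/
inductive Exec : Prog → RamState → ℕ → ℕ → RamState → Prop where
  | instr (i : Instr) (s : RamState) : Exec (Prog.instr i) s 1 (i.bitCost s) (i.run s)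
  | seq {p q : Prog} {s s' s'' : RamState} {t b t' b' : ℕ} :
      Exec p s t b s' → Exec q s' t' b' s'' → Exec (Prog.seq p q) s (t + t') (b + b') s''
  | ite_true {x : ℕ} {p q : Prog} {s s' : RamState} {t b : ℕ} :
      s.reg x ≠ 0 → Exec p s t b s' →
      Exec (Prog.ite x p q) s (1 + t) (1 + (s.reg x).size + b) s'
  | ite_false {x : ℕ} {p q : Prog} {s s' : RamState} {t b : ℕ} :
      s.reg x = 0 → Exec q s t b s' →
      Exec (Prog.ite x p q) s (1 + t) (1 + (s.reg x).size + b) s'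
  | loop_done {x : ℕ} {p : Prog} {s : RamState} :
      s.reg x = 0 → Exec (Prog.loop x p) s 1 (1 + (s.reg x).size) s
  | loop_next {x : ℕ} {p : Prog} {s s' s'' : RamState} {t b t' b' : ℕ} :
      s.reg x ≠ 0 → Exec p s t b s' → Exec (Prog.loop x p) s' t' b' s'' →
      Exec (Prog.loop x p) s (1 + t + t') (1 + (s.reg x).size + b + b') s''

/-- The initial memory: the input is in array `0`, and everything else is zero. -/
def RamState.ofInput (l : List ℕ) : RamState where
  reg := fun _ => 0
  arr := fun a i => if a = 0 then l.getD i 0 else 0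

/-- The number of bits of an input. -/
def bitLength (l : List ℕ) : ℕ :=
  (l.map fun v => 1 + v.size).sum

open Classical in
/-- On the history `h`, the program `p` halts after `t` steps of total logarithmic cost `b`, with
the correct answer (`1` for yes, `0` for no) to the question whether `h` is serializable. -/
def ChecksSer (p : Prog) (h : History) (t b : ℕ) : Prop :=
  ∃ s, Exec p (RamState.ofInput h.encode) t b s ∧ s.reg 0 = if h.Serializable then 1 else 0

/-! Build a commit order one transaction at a time. A transaction `t` may be appended to a prefix
`P` when it is new, all its predecessors lie in `P`, and it does not slip in between some `a ∈ P`
and another transaction `c ∉ P` that reads from `a` a variable written by `t`. This condition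
(`Extends`) depends on the set `P` only, not on the order inside it. Hence a history is serializable
iff the set of all transactions is reachable from `∅` by such steps (`serializable_iff_reach`).

Reachable sets are downward closed for the session order, so each is generated by its maximal
elements. These form an antichain, hence there are at most `1 + size ^ width` reachable sets
(`card_prefixes_le`). Breadth-first search visits each of them once and tries each of the `n = size`
transactions against all `n * n` pairs `(a, c)`, which costs `O(n ^ 3)` per set (`visit_ok`,
`search_ok`). Each pair takes constant time because the relations are tabulated beforehand; the
table of conflicts needs two passes over the operations per transaction, within `O(n * N)`
(`preprocess_ok`). A set is coded as a sum of powers of two, and the code serves as an array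
address.

Programs are written in a small language with expressions, which is compiled to the machine. The
triples `Ok` combine total correctness, a time bound and a frame condition, and loops are paid for
by a potential. The logarithmic cost needs no separate analysis: a step lengthens the numbers in
memory by at most one bit once the constants are accounted for, so polynomially many steps have
polynomial bit cost (`Exec.bits_le`). -/

/-! ### A small imperative language compiled to the machine -/

namespace RamState

/-- Assign a register. -/
def setReg (s : RamState) (x v : ℕ) : RamState :=
  { s with reg := Function.update s.reg x v }

/-- Assign an array cell. -/
def setArr (s : RamState) (a i v : ℕ) : RamState :=
  { s with arr := Function.update s.arr a (Function.update (s.arr a) i v) }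

@[simp] theorem setReg_reg (s : RamState) (x v y : ℕ) :
    (s.setReg x v).reg y = if y = x then v else s.reg y := by
  simp [setReg, Function.update_apply]

@[simp] theorem setReg_arr (s : RamState) (x v : ℕ) : (s.setReg x v).arr = s.arr := rfl

@[simp] theorem setArr_reg (s : RamState) (a i v : ℕ) : (s.setArr a i v).reg = s.reg := rfl

theorem setArr_arr (s : RamState) (a i v b : ℕ) :
    (s.setArr a i v).arr b = if b = a then Function.update (s.arr a) i v else s.arr b := by
  simp [setArr, Function.update_apply]

@[simp] theorem setArr_arr_apply (s : RamState) (a i v b j : ℕ) :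
    (s.setArr a i v).arr b j = if b = a ∧ j = i then v else s.arr b j := by
  rw [setArr_arr]
  by_cases hb : b = a
  · subst hb; simp [Function.update_apply]
  · simp [hb]

end RamState

/-- Expressions over variables and arrays. -/
inductive Ex where
  | lit (c : ℕ)
  | var (x : ℕ)
  | add (e f : Ex)
  | sub (e f : Ex)
  | get (a : ℕ) (e : Ex)

namespace Ex

/-- The value of an expression. -/
@[simp] def val (s : RamState) : Ex → ℕ
  | lit c => c
  | var x => s.reg x
  | add e f => e.val s + f.val s
  | sub e f => e.val s - f.val s
  | get a e => s.arr a (e.val s)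

/-- Evaluation time. -/
@[simp] def cost : Ex → ℕ
  | lit _ => 1
  | var _ => 2
  | add e f => e.cost + f.cost + 1
  | sub e f => e.cost + f.cost + 1
  | get _ e => e.cost + 1

/-- Code that evaluates an expression into the `d`-th temporary register. Variables live in the
even registers and temporaries in the odd ones. -/
def code : Ex → ℕ → Prog
  | lit c, d => .instr (.const (2 * d + 1) c)
  | var x, d => .seq (.instr (.const (2 * d + 1) 0)) (.instr (.add (2 * d + 1) (2 * d + 1) (2 * x)))
  | add e f, d =>
    .seq (.seq (e.code d) (f.code (d + 1))) (.instr (.add (2 * d + 1) (2 * d + 1) (2 * (d + 1) + 1)))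
  | sub e f, d =>
    .seq (.seq (e.code d) (f.code (d + 1))) (.instr (.sub (2 * d + 1) (2 * d + 1) (2 * (d + 1) + 1)))
  | get a e, d => .seq (e.code d) (.instr (.load (2 * d + 1) a (2 * d + 1)))

/-- Negation; nonzero values count as true. -/
def not (e : Ex) : Ex := sub (lit 1) e

/-- Disjunction. -/
def or (e f : Ex) : Ex := add e f

/-- Conjunction. -/
def and (e f : Ex) : Ex := sub e (sub e f)

/-- Equality test. -/
def eq (e f : Ex) : Ex := not (add (sub e f) (sub f e))

variable (s : RamState) (e f : Ex)

@[simp] theorem val_not_eq_zero : (not e).val s = 0 ↔ e.val s ≠ 0 := by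
  simp only [not, val]; omega

@[simp] theorem val_or_eq_zero : (or e f).val s = 0 ↔ e.val s = 0 ∧ f.val s = 0 := by
  simp only [or, val]; omega

-- With truncated subtraction `e - (e - f)` is the minimum of the two values.
@[simp] theorem val_and_eq_zero : (and e f).val s = 0 ↔ e.val s = 0 ∨ f.val s = 0 := by
  simp only [and, val]; omega

@[simp] theorem val_eq_eq_zero : (eq e f).val s = 0 ↔ e.val s ≠ f.val s := by
  simp only [eq, val_not_eq_zero, val]; omega

end Ex

/-- The machine state `σ` represents the variables and arrays of `s`. -/
def Sim (σ s : RamState) : Prop :=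
  (∀ x, σ.reg (2 * x) = s.reg x) ∧ σ.arr = s.arr

/-- Preservation of the lower temporaries is what carries the induction: the second operand of a sum
is evaluated at depth `d + 1` while the first one waits at depth `d`. The bit cost is left
unspecified, since it is bounded globally from the number of steps. -/
theorem Ex.exec_code (e : Ex) : ∀ (d : ℕ) (σ s : RamState), Sim σ s →
    ∃ b σ', Exec (e.code d) σ e.cost b σ' ∧ Sim σ' s ∧ σ'.reg (2 * d + 1) = e.val s ∧
      ∀ d' < d, σ'.reg (2 * d' + 1) = σ.reg (2 * d' + 1) := by
  -- Writing to an odd register is invisible to `Sim`, which looks at even registers and arrays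
  -- only.
  have key : ∀ (σ s : RamState) (d v : ℕ), Sim σ s →
      Sim { σ with reg := Function.update σ.reg (2 * d + 1) v } s ∧
      Function.update σ.reg (2 * d + 1) v (2 * d + 1) = v ∧
      ∀ d' < d, Function.update σ.reg (2 * d + 1) v (2 * d' + 1) = σ.reg (2 * d' + 1) := by
    intro σ s d v h
    refine ⟨⟨fun x => ?_, h.2⟩, by simp, fun d' hd => ?_⟩
    · rw [← h.1 x]; exact Function.update_of_ne (by omega) _ _
    · exact Function.update_of_ne (by omega) _ _
  induction e with
  | lit c =>
    intro d σ s h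
    exact ⟨_, _, Exec.instr _ _, key σ s d c h⟩
  | var x =>
    intro d σ s h
    have h1 := key σ s d 0 h
    have h2 := key _ s d (s.reg x) h1.1
    refine ⟨_, _, Exec.seq (Exec.instr _ _) (Exec.instr _ _), ?_⟩
    have hx : Function.update σ.reg (2 * d + 1) 0 (2 * x) = s.reg x := h1.1.1 x
    simp only [Instr.run, h1.2.1, hx, zero_add]
    exact ⟨h2.1, h2.2.1, fun d' hd => (h2.2.2 d' hd).trans (h1.2.2 d' hd)⟩
  | add e f ihe ihf =>
    intro d σ s h
    obtain ⟨b₁, σ₁, E₁, S₁, v₁, k₁⟩ := ihe d σ s h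
    obtain ⟨b₂, σ₂, E₂, S₂, v₂, k₂⟩ := ihf (d + 1) σ₁ s S₁
    have h2 := key σ₂ s d (e.val s + f.val s) S₂
    refine ⟨_, _, Exec.seq (Exec.seq E₁ E₂) (Exec.instr _ _), ?_⟩
    simp only [Instr.run, v₂, k₂ d (by omega), v₁]
    exact ⟨h2.1, h2.2.1, fun d' hd =>
      (h2.2.2 d' hd).trans ((k₂ d' (by omega)).trans (k₁ d' hd))⟩
  | sub e f ihe ihf =>
    intro d σ s h
    obtain ⟨b₁, σ₁, E₁, S₁, v₁, k₁⟩ := ihe d σ s h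
    obtain ⟨b₂, σ₂, E₂, S₂, v₂, k₂⟩ := ihf (d + 1) σ₁ s S₁
    have h2 := key σ₂ s d (e.val s - f.val s) S₂
    refine ⟨_, _, Exec.seq (Exec.seq E₁ E₂) (Exec.instr _ _), ?_⟩
    simp only [Instr.run, v₂, k₂ d (by omega), v₁]
    exact ⟨h2.1, h2.2.1, fun d' hd =>
      (h2.2.2 d' hd).trans ((k₂ d' (by omega)).trans (k₁ d' hd))⟩
  | get a e ihe =>
    intro d σ s h
    obtain ⟨b₁, σ₁, E₁, S₁, v₁, k₁⟩ := ihe d σ s h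
    have h2 := key σ₁ s d (s.arr a (e.val s)) S₁
    refine ⟨_, _, Exec.seq E₁ (Exec.instr _ _), ?_⟩
    simp only [Instr.run, v₁, S₁.2]
    exact ⟨by simpa only [S₁.2] using h2.1, h2.2.1, fun d' hd => (h2.2.2 d' hd).trans (k₁ d' hd)⟩

/-- Statements. -/
inductive Stm where
  | set (x : ℕ) (e : Ex)
  | put (a : ℕ) (e f : Ex)
  | seq (p q : Stm)
  | ite (e : Ex) (p q : Stm)
  | loop (e : Ex) (p : Stm)

infixr:60 " ;; " => Stm.seq

namespace Stm

/-- The machine program of a statement. -/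
def prog : Stm → Prog
  | set x e => .seq (e.code 0) (.seq (.instr (.const 3 0)) (.instr (.add (2 * x) 1 3)))
  | put a e f => .seq (.seq (e.code 0) (f.code 1)) (.instr (.store a 1 3))
  | seq p q => .seq p.prog q.prog
  | ite e p q => .seq (e.code 0) (.ite 1 p.prog q.prog)
  | .loop e p => .seq (e.code 0) (.loop 1 (.seq p.prog (e.code 0)))

/-- Variables that a statement may assign. -/
def setsReg : Stm → ℕ → Bool
  | set x _, r => r == x
  | put _ _ _, _ => false
  | seq p q, r => p.setsReg r || q.setsReg r
  | ite _ p q, r => p.setsReg r || q.setsReg r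
  | .loop _ p, r => p.setsReg r

/-- Arrays that a statement may change. -/
def setsArr : Stm → ℕ → Bool
  | set _ _, _ => false
  | put a _ _, r => r == a
  | seq p q, r => p.setsArr r || q.setsArr r
  | ite _ p q, r => p.setsArr r || q.setsArr r
  | .loop _ p, r => p.setsArr r

/-- Statements without loops. -/
def flat : Stm → Bool
  | set _ _ => true
  | put _ _ _ => true
  | seq p q => p.flat && q.flat
  | ite _ p q => p.flat && q.flat
  | .loop _ _ => false

/-- The effect of a statement without loops. -/
@[simp] def run (s : RamState) : Stm → RamState
  | set x e => s.setReg x (e.val s)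
  | put a e f => s.setArr a (e.val s) (f.val s)
  | seq p q => q.run (p.run s)
  | ite e p q => if e.val s ≠ 0 then p.run s else q.run s
  | .loop _ _ => s

/-- A bound on the running time of a statement without loops. -/
@[simp] def time : Stm → ℕ
  | set _ e => e.cost + 2
  | put _ e f => e.cost + f.cost + 1
  | seq p q => p.time + q.time
  | ite e p q => e.cost + 1 + (p.time + q.time)
  | .loop _ _ => 0

end Stm

/-! ### Program logic with time bounds -/

/-- The states `s` and `s'` agree on everything that `p` never assigns. -/
def Frame (p : Stm) (s s' : RamState) : Prop :=
  (∀ r, p.setsReg r = false → s'.reg r = s.reg r) ∧ ∀ a, p.setsArr a = false → s'.arr a = s.arr a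

theorem Frame.trans {p : Stm} {s s' s'' : RamState} (h : Frame p s s') (h' : Frame p s' s'') :
    Frame p s s'' :=
  ⟨fun r hr => (h'.1 r hr).trans (h.1 r hr), fun a ha => (h'.2 a ha).trans (h.2 a ha)⟩

theorem Frame.refl (p : Stm) (s : RamState) : Frame p s s := ⟨fun _ _ => rfl, fun _ _ => rfl⟩

theorem Frame.mono {p q : Stm} {s s' : RamState} (h : Frame p s s')
    (hr : ∀ r, q.setsReg r = false → p.setsReg r = false)
    (ha : ∀ a, q.setsArr a = false → p.setsArr a = false) : Frame q s s' :=
  ⟨fun r h' => h.1 r (hr r h'), fun a h' => h.2 a (ha a h')⟩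

/-- Total correctness with time: from `s`, the statement `p` ends within `T` steps in a state that
satisfies `Q`. -/
def Ok (p : Stm) (s : RamState) (T : ℕ) (Q : RamState → Prop) : Prop :=
  ∀ σ, Sim σ s → ∃ t b σ' s', Exec p.prog σ t b σ' ∧ t ≤ T ∧ Sim σ' s' ∧ Frame p s s' ∧ Q s'

namespace Ok

variable {p q : Stm} {s : RamState} {T T' : ℕ} {Q Q' : RamState → Prop}

theorem mono (h : Ok p s T Q) (hT : T ≤ T') (hQ : ∀ s', Frame p s s' → Q s' → Q' s') :
    Ok p s T' Q' := by
  intro σ hσ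
  obtain ⟨t, b, σ', s', h1, h2, h3, h4, h5⟩ := h σ hσ
  exact ⟨t, b, σ', s', h1, h2.trans hT, h3, h4, hQ s' h4 h5⟩

/-- Handing the frame of `p` to the proof about `q` keeps postconditions short: facts about
variables that `p` never assigns need not be repeated in `R`. -/
theorem seq {R : RamState → Prop} (h : Ok p s T R) (h' : ∀ s', Frame p s s' → R s' → Ok q s' T' Q) :
    Ok (p ;; q) s (T + T') Q := by
  intro σ hσ
  obtain ⟨t, b, σ', s', h1, h2, h3, h4, h5⟩ := h σ hσ
  obtain ⟨t', b', σ'', s'', h1', h2', h3', h4', h5'⟩ := h' s' h4 h5 σ' h3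
  refine ⟨_, _, _, s'', Exec.seq h1 h1', by omega, h3', ?_, h5'⟩
  refine (h4.mono ?_ ?_).trans (h4'.mono ?_ ?_) <;> simp +contextual [Stm.setsReg, Stm.setsArr]

theorem set (x : ℕ) (e : Ex) : Ok (.set x e) s (e.cost + 2) (· = s.setReg x (e.val s)) := by
  intro σ hσ
  obtain ⟨b, σ', E, S, v, -⟩ := e.exec_code 0 σ s hσ
  refine ⟨_, _, _, s.setReg x (e.val s),
    Exec.seq E (Exec.seq (Exec.instr _ _) (Exec.instr _ _)), le_rfl, ?_, ?_, rfl⟩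
  · refine ⟨fun y => ?_, S.2⟩
    have hv : σ'.reg 1 = e.val s := v
    by_cases hy : y = x
    · subst hy; simp [Instr.run, hv]
    · have : 2 * y ≠ 2 * x := by omega
      have h3 : 2 * y ≠ 3 := by omega
      simp [Instr.run, hy, h3, S.1 y]
  · refine ⟨fun r hr => ?_, fun a _ => rfl⟩
    simp [Stm.setsReg] at hr
    simp [hr]

theorem put (a : ℕ) (e f : Ex) :
    Ok (.put a e f) s (e.cost + f.cost + 1) (· = s.setArr a (e.val s) (f.val s)) := by
  intro σ hσ
  obtain ⟨b₁, σ₁, E₁, S₁, v₁, -⟩ := e.exec_code 0 σ s hσ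
  obtain ⟨b₂, σ₂, E₂, S₂, v₂, k₂⟩ := f.exec_code 1 σ₁ s S₁
  refine ⟨_, _, _, s.setArr a (e.val s) (f.val s),
    Exec.seq (Exec.seq E₁ E₂) (Exec.instr _ _), le_rfl, ⟨S₂.1, ?_⟩, ?_, rfl⟩
  · have h1 : σ₂.reg 1 = e.val s := (k₂ 0 (by omega)).trans v₁
    have h3 : σ₂.reg 3 = f.val s := v₂
    simp [Instr.run, h1, h3, S₂.2, RamState.setArr]
  · refine ⟨fun r _ => rfl, fun r hr => ?_⟩
    simp [Stm.setsArr] at hr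
    simp [RamState.setArr_arr, hr]

/-- Charging for both branches affects constants only and avoids a maximum. -/
theorem ite {e : Ex} (h : e.val s ≠ 0 → Ok p s T Q) (h' : e.val s = 0 → Ok q s T' Q) :
    Ok (.ite e p q) s (e.cost + 1 + (T + T')) Q := by
  intro σ hσ
  obtain ⟨b, σ', E, S, v, -⟩ := e.exec_code 0 σ s hσ
  by_cases he : e.val s = 0
  · obtain ⟨t, b, σ'', s', h1, h2, h3, h4, h5⟩ := h' he σ' S
    refine ⟨_, _, _, s', Exec.seq E (Exec.ite_false (v.trans he) h1), by omega, h3, ?_, h5⟩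
    refine h4.mono ?_ ?_ <;> simp +contextual [Stm.setsReg, Stm.setsArr]
  · obtain ⟨t, b, σ'', s', h1, h2, h3, h4, h5⟩ := h he σ' S
    refine ⟨_, _, _, s', Exec.seq E (Exec.ite_true (fun h0 => he (v.symm.trans h0)) h1), by omega,
      h3, ?_, h5⟩
    refine h4.mono ?_ ?_ <;> simp +contextual [Stm.setsReg, Stm.setsArr]

theorem run_time : ∀ (p : Stm) (s : RamState), p.flat = true → Ok p s p.time (· = p.run s)
  | .set x e, s, _ => set x e
  | .put a e f, s, _ => put a e f
  | .seq p q, s, h => by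
    simp only [Stm.flat, Bool.and_eq_true] at h
    refine (run_time p s h.1).seq fun s' _ hs' => ?_
    subst hs'
    exact run_time q _ h.2
  | .ite e p q, s, h => by
    simp only [Stm.flat, Bool.and_eq_true] at h
    refine ite (fun he => (run_time p s h.1).mono le_rfl ?_)
      (fun he => (run_time q s h.2).mono le_rfl ?_)
    · rintro _ _ rfl; simp [he]
    · rintro _ _ rfl; simp [he]
  | .loop e p, s, h => by simp [Stm.flat] at h

theorem of_flat (hp : p.flat = true) (hT : p.time ≤ T) (hQ : Frame p s (p.run s) → Q (p.run s)) :
    Ok p s T Q :=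
  (run_time p s hp).mono hT (by rintro _ hF rfl; exact hQ hF)

/-- The rule for loops, with an invariant and a potential that pays for the running time. -/
theorem loop {e : Ex} (I : RamState → Prop) (μ : RamState → ℕ) (h0 : I s)
    (hstep : ∀ s, I s → e.val s ≠ 0 →
      ∃ T, Ok p s T (fun s' => I s' ∧ μ s' + (T + e.cost + 1) ≤ μ s)) :
    Ok (.loop e p) s (e.cost + 1 + μ s) (fun s' => I s' ∧ e.val s' = 0) := by
  -- The compiled loop tests register 1, so the induction starts where the guard has already been
  -- evaluated. Each round lowers the potential by the cost of the body, the new evaluation of the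
  -- guard and the test, which also makes the induction well founded.
  have main : ∀ (m : ℕ) (s : RamState), μ s ≤ m → I s → ∀ σ, Sim σ s → σ.reg 1 = e.val s →
      ∃ t b σ' s', Exec (.loop 1 (.seq p.prog (e.code 0))) σ t b σ' ∧ t ≤ μ s + 1 ∧ Sim σ' s' ∧
        Frame (.loop e p) s s' ∧ I s' ∧ e.val s' = 0 := by
    intro m
    induction m using Nat.strong_induction_on with
    | _ m ih =>
      intro s hm hI σ hσ hv
      by_cases he : e.val s = 0
      · exact ⟨_, _, _, s, Exec.loop_done (hv.trans he), by omega, hσ, Frame.refl _ _, hI, he⟩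
      · obtain ⟨T, hT⟩ := hstep s hI he
        obtain ⟨t, b, σ', s', h1, h2, h3, h4, h5, h6⟩ := hT σ hσ
        obtain ⟨b', σ'', E, S, v, -⟩ := e.exec_code 0 σ' s' h3
        obtain ⟨t3, b3, σ3, s3, g1, g2, g3, g4, g5⟩ :=
          ih (μ s') (by omega) s' le_rfl h5 σ'' S v
        refine ⟨_, _, _, s3, Exec.loop_next (fun h0 => he (hv.symm.trans h0)) (Exec.seq h1 E) g1,
          by omega, g3, Frame.trans (h4.mono ?_ ?_) g4, g5⟩ <;> simp [Stm.setsReg, Stm.setsArr]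
  intro σ hσ
  obtain ⟨b, σ', E, S, v, -⟩ := e.exec_code 0 σ s hσ
  obtain ⟨t, b', σ'', s', h1, h2, h3, h4, h5⟩ := main _ s le_rfl h0 σ' S v
  exact ⟨_, _, _, s', Exec.seq E h1, by omega, h3, h4, h5⟩

end Ok

/-! ### Counted loops -/

/-- The loop `for i := 0, …, lim - 1`. -/
def Stm.upTo (i lim : ℕ) (p : Stm) : Stm :=
  .set i (.lit 0) ;; .loop (.sub (.var lim) (.var i)) (p ;; .set i (.add (.var i) (.lit 1)))

/-- The overhead of a round is 6 for the increment plus 6 for the guard and its test; the 9 is 3 for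
the initial assignment plus 6 for the first test. The body may not assign the counter or its limit.
-/
theorem Ok.upTo {p : Stm} {i lim n : ℕ} {s₀ : RamState} (I : ℕ → RamState → Prop) (T : ℕ → ℕ)
    (hn : s₀.reg lim = n) (hi : p.setsReg i = false) (hlim : p.setsReg lim = false)
    (hil : lim ≠ i) (h0 : I 0 (s₀.setReg i 0))
    (hstep : ∀ k < n, ∀ s, s.reg i = k → Frame (.upTo i lim p) s₀ s → I k s →
      Ok p s (T k) (fun s' => I (k + 1) (s'.setReg i (k + 1)))) :
    Ok (.upTo i lim p) s₀ (9 + ∑ k ∈ Finset.range n, (T k + 12))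
      (fun s => s.reg i = n ∧ I n s) := by
  have hFS : ∀ s s', Frame (.loop (.sub (.var lim) (.var i))
      (p ;; .set i (.add (.var i) (.lit 1)))) s s' → Frame (.upTo i lim p) s s' := by
    intro s s' h
    refine h.mono ?_ ?_ <;> simp +contextual [Stm.upTo, Stm.setsReg, Stm.setsArr]
  have hF0 : Frame (.upTo i lim p) s₀ (s₀.setReg i 0) :=
    ⟨fun r hr => by simp [Stm.upTo, Stm.setsReg] at hr; simp [hr], fun _ _ => rfl⟩
  have hw := Ok.loop (s := s₀.setReg i 0) (e := .sub (.var lim) (.var i))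
    (p := p ;; .set i (.add (.var i) (.lit 1)))
    (fun s => s.reg i ≤ n ∧ s.reg lim = n ∧ Frame (.upTo i lim p) s₀ s ∧ I (s.reg i) s)
    -- The potential is the total cost of the rounds still to come.
    (fun s => ∑ k ∈ Finset.Ico (s.reg i) n, (T k + 12)) ?_ ?_
  · have := (Ok.set (s := s₀) i (.lit 0)).seq (q := .loop (.sub (.var lim) (.var i))
        (p ;; .set i (.add (.var i) (.lit 1)))) (fun s' _ hs' => by subst hs'; exact hw)
    refine this.mono ?_ ?_
    · simp only [RamState.setReg_reg, if_true, Finset.range_eq_Ico, Ex.cost]; omega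
    · rintro s' _ ⟨⟨h1, h2, -, h4⟩, h3⟩
      simp only [Ex.val, h2] at h3
      have : s'.reg i = n := by omega
      exact ⟨this, this ▸ h4⟩
  · simp only [RamState.setReg_reg, if_true, hil, if_false]
    exact ⟨Nat.zero_le _, hn, hF0, h0⟩
  · rintro s ⟨h1, h2, h3, h4⟩ he
    simp only [Ex.val, h2] at he
    refine ⟨T (s.reg i) + 6, ?_⟩
    have hT : T (s.reg i) + 6 = T (s.reg i) + ((Ex.add (.var i) (.lit 1)).cost + 2) := by simp
    rw [hT]
    refine (hstep (s.reg i) (by omega) s rfl h3 h4).seq fun s' hF hI => ?_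
    refine (Ok.set i _).mono le_rfl ?_
    rintro _ hF' rfl
    have e1 : s'.reg i = s.reg i := hF.1 i hi
    simp only [Ex.val, e1] at hF'
    have e2 : s'.reg lim = n := (hF.1 lim hlim).trans h2
    simp only [RamState.setReg_reg, if_true, Ex.val, e1, hil, if_false]
    refine ⟨⟨by omega, e2, ?_, hI⟩, ?_⟩
    · refine h3.trans (Frame.trans (hF.mono ?_ ?_) (hF'.mono ?_ ?_)) <;>
        simp +contextual [Stm.upTo, Stm.setsReg, Stm.setsArr]
    · have hlt : s.reg i < n := by omega
      rw [Finset.sum_eq_sum_Ico_succ_bot hlt]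
      simp only [Ex.cost]; omega

theorem Ok.upTo_const {p : Stm} {i lim n : ℕ} {s₀ : RamState} (I : ℕ → RamState → Prop) (T : ℕ)
    (hn : s₀.reg lim = n) (hi : p.setsReg i = false) (hlim : p.setsReg lim = false)
    (hil : lim ≠ i) (h0 : I 0 (s₀.setReg i 0))
    (hstep : ∀ k < n, ∀ s, s.reg i = k → Frame (.upTo i lim p) s₀ s → I k s →
      Ok p s T (fun s' => I (k + 1) (s'.setReg i (k + 1)))) :
    Ok (.upTo i lim p) s₀ (9 + n * (T + 12)) (fun s => s.reg i = n ∧ I n s) :=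
  (Ok.upTo I (fun _ => T) hn hi hlim hil h0 hstep).mono (by simp) fun _ _ h => h

/-- The loop `for j := 0, …, lim - 1 do if c then a[e] := f`; the variable `0` is a dummy. -/
def Stm.mark (j lim a : ℕ) (c e f : Ex) : Stm :=
  .upTo j lim (.ite c (.put a e f) (.set 0 (.lit 0)))

open Classical in
-- All marks have the same value `V`, so their order and repetitions do not matter. The hypothesis
-- `hs` makes the test and the address independent of the array being marked. The proposition `D`
-- lets each application supply its own description of the marked cells.
theorem Ok.mark {j lim a n V T : ℕ} {c e f : Ex} {s₀ : RamState} (C : ℕ → Prop) (A : ℕ → ℕ)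
    (hn : s₀.reg lim = n) (hj : j ≠ 0) (hlim : lim ≠ 0) (hjl : lim ≠ j)
    (hT : c.cost + e.cost + f.cost + 5 ≤ T)
    (hs : ∀ k < n, ∀ s : RamState, s.reg j = k → (∀ r, r ≠ 0 → r ≠ j → s.reg r = s₀.reg r) →
      (∀ b, b ≠ a → s.arr b = s₀.arr b) →
      (c.val s = 0 ↔ ¬ C k) ∧ (C k → e.val s = A k) ∧ f.val s = V) :
    Ok (.mark j lim a c e f) s₀ (9 + n * (T + 12))
      (fun s => ∀ x, ∀ D : Prop, ((∃ k < n, C k ∧ A k = x) ↔ D) →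
        (D → s.arr a x = V) ∧ (¬ D → s.arr a x = s₀.arr a x)) := by
  refine (Ok.upTo_const (fun k s => ∀ x, s.arr a x = if ∃ k' < k, C k' ∧ A k' = x then V
    else s₀.arr a x) T hn (by simpa [Stm.setsReg] using hj) (by simpa [Stm.setsReg] using hlim)
    hjl (by simp) ?_).mono le_rfl fun _ _ h x D hD => by rw [h.2 x]; simp +contextual [hD]
  intro k hk s hjk hF hI
  obtain ⟨h1, h2, h3⟩ := hs k hk s hjk
    (fun r hr hr' => hF.1 r (by simp [Stm.upTo, Stm.setsReg, hr, hr']))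
    (fun b hb => hF.2 b (by simp [Stm.upTo, Stm.setsArr, hb]))
  refine Ok.of_flat rfl (by simp only [Stm.time, Ex.cost]; omega) fun _ x => ?_
  by_cases hC : C k
  · have hc : c.val s ≠ 0 := fun h0 => h1.1 h0 hC
    simp only [Stm.run, hc, ne_eq, not_false_eq_true, if_true, RamState.setReg_arr,
      RamState.setArr_arr_apply, true_and, h2 hC, h3]
    by_cases hx : x = A k
    · rw [if_pos hx, if_pos ⟨k, by omega, hC, hx.symm⟩]
    · rw [if_neg hx, hI x]
      congr 1
      refine propext ⟨fun ⟨k', hk', h⟩ => ⟨k', by omega, h⟩, fun ⟨k', hk', h⟩ => ⟨k', ?_, h⟩⟩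
      have : k' ≠ k := by rintro rfl; exact hx h.2.symm
      omega
  · simp only [Stm.run, h1.2 hC, ne_eq, not_true_eq_false, if_false, RamState.setReg_arr, hI x]
    congr 1
    refine propext ⟨fun ⟨k', hk', h⟩ => ⟨k', by omega, h⟩, fun ⟨k', hk', h⟩ => ⟨k', ?_, h⟩⟩
    have : k' ≠ k := by rintro rfl; exact hC h.1
    omega

/-! ### Serializability as reachability between prefixes -/

namespace History

variable (h : History)

/-- `a` has to commit before `b`. -/
def Pred (a b : Fin h.size) : Prop := h.so a b = true ∨ h.wr a b

/-- `t` writes a variable that `c` reads from `a`. -/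
def Conflict (t a c : Fin h.size) : Prop := ∃ x, h.wrOn x a c ∧ h.Writes t x

/-- The prefix `P` of a commit order can be continued by `t`. -/
def Extends (P : Finset (Fin h.size)) (t : Fin h.size) : Prop :=
  t ∉ P ∧ (∀ a, h.Pred a t → a ∈ P) ∧ ∀ a ∈ P, ∀ c ∉ P, c ≠ t → ¬ h.Conflict t a c

/-- Prefixes that arise from the empty one by continuing step by step. -/
inductive Reach : Finset (Fin h.size) → Prop where
  | empty : Reach ∅
  | step {P : Finset (Fin h.size)} {t : Fin h.size} :
      Reach P → h.Extends P t → Reach (insert t P)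

variable {h}

/-- The rank is the time of insertion, and transactions not yet inserted share the rank `P.card`, as
if they came last. With this convention the axiom on commit orders makes sense for prefixes, and
`Extends` is what it demands at the moment when `t` is inserted. -/
theorem Reach.exists_rank {P : Finset (Fin h.size)} (hP : h.Reach P) :
    ∃ r : Fin h.size → ℕ, (∀ a ∈ P, r a < P.card) ∧ (∀ a ∉ P, r a = P.card) ∧
      Set.InjOn r P ∧ (∀ a, ∀ b ∈ P, h.Pred a b → r a < r b) ∧
      ∀ t ∈ P, ∀ a c, h.Conflict t a c → a ≠ t → r t < r c → r t < r a := by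
  induction hP with
  | empty => exact ⟨fun _ => 0, by simp⟩
  | @step P t _ ht ih =>
    obtain ⟨r, h1, h2, h3, h4, h5⟩ := ih
    obtain ⟨e1, e2, e3⟩ := ht
    have hc : (insert t P).card = P.card + 1 := Finset.card_insert_of_notMem e1
    have hrt := h2 t e1
    have hle : ∀ a, r a ≤ P.card := fun a => by
      by_cases ha : a ∈ P
      · exact (h1 a ha).le
      · exact (h2 a ha).le
    -- The new transaction already has rank `P.card` and keeps it; those still outside move up by
    -- one.
    refine ⟨fun a => if a ∈ insert t P then r a else P.card + 1, ?_, ?_, ?_, ?_, ?_⟩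
    · intro a ha
      simp only [ha, if_true, hc]
      have := hle a; omega
    · intro a ha
      simp only [ha, if_false, hc]
    · intro a ha b hb hab
      have ha' : a ∈ insert t P := ha
      have hb' : b ∈ insert t P := hb
      simp only [ha', hb', if_true] at hab
      rcases Finset.mem_insert.1 ha' with rfl | ha'
      · rcases Finset.mem_insert.1 hb' with rfl | hb'
        · rfl
        · have := h1 b hb'; omega
      · rcases Finset.mem_insert.1 hb' with hbt | hb'
        · have := h1 a ha'; rw [hbt] at hab; omega
        · exact h3 ha' hb' hab
    · intro a b hb hab
      simp only [hb, if_true]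
      have haP : a ∈ P ∧ r a < r b := by
        rcases Finset.mem_insert.1 hb with rfl | hb
        · have := e2 a hab
          exact ⟨this, by rw [hrt]; exact h1 a this⟩
        · have h6 := h4 a b hb hab
          refine ⟨?_, h6⟩
          by_contra ha
          have := h2 a ha; have := h1 b hb; omega
      simp [haP]
    · intro u hu a c hcf hau huc
      simp only [hu, if_true] at huc ⊢
      -- If `u` is the new transaction, then `c` is still outside, and `a ∈ P` would be a forbidden
      -- conflict. If `u` is older, moving the outsiders up changes no comparison with its rank.
      rcases Finset.mem_insert.1 hu with rfl | huP
      · have hcn : c ∉ insert u P := by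
          intro hc'
          simp only [hc', if_true] at huc
          have := hle c; omega
        have ha : a ∉ insert u P := by
          intro ha
          have haP : a ∈ P := (Finset.mem_insert.1 ha).resolve_left hau
          exact e3 a haP c (fun h => hcn (Finset.mem_insert_of_mem h))
            (fun h => hcn (h ▸ Finset.mem_insert_self _ _)) hcf
        simp only [ha, if_false]; omega
      · have h6 := h1 u huP
        have huc' : r u < r c := by
          by_cases hcP : c ∈ insert t P
          · simpa only [hcP, if_true] using huc
          · rw [h2 c (fun h => hcP (Finset.mem_insert_of_mem h))]; exact h6
        have h7 := h5 u huP a c hcf hau huc'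
        split_ifs
        · exact h7
        · omega

/-- Remove the `co`-last element `t` of an initial segment and induct. If `t` conflicted with `a`
inside and `c` outside, then `c` would come after `t`, so the axiom would put `t` before `a`,
against the choice of `t`. -/
theorem Serializable.reach {co : Fin h.size → Fin h.size → Prop}
    [IsStrictTotalOrder (Fin h.size) co]
    (hso : ∀ t₁ t₂, h.so t₁ t₂ = true → co t₁ t₂) (hwr : ∀ t₁ t₂, h.wr t₁ t₂ → co t₁ t₂)
    (hax : ∀ x t₁ t₂ t₃, t₁ ≠ t₂ → h.wrOn x t₁ t₃ → h.Writes t₂ x → co t₂ t₃ → co t₂ t₁)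
    (P : Finset (Fin h.size)) (hP : ∀ a b, co a b → b ∈ P → a ∈ P) : h.Reach P := by
  classical
  induction hn : P.card generalizing P with
  | zero => rw [Finset.card_eq_zero.1 hn]; exact Reach.empty
  | succ m ih =>
    have hne : P.Nonempty := Finset.card_pos.1 (by omega)
    obtain ⟨t, htP, hmax⟩ : ∃ t ∈ P, ∀ b ∈ P, ¬ co t b := by
      have hwf : WellFounded (fun a b => co b a) := Finite.wellFounded_of_trans_of_irrefl _
      obtain ⟨t, ht, h'⟩ := hwf.has_min (P : Set (Fin h.size)) hne
      exact ⟨t, ht, h'⟩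
    have hR := ih (P.erase t) (fun a b hab hb => by
      rw [Finset.mem_erase] at hb ⊢
      refine ⟨?_, hP a b hab hb.2⟩
      rintro rfl
      exact hmax b hb.2 hab) (by rw [Finset.card_erase_of_mem htP]; omega)
    rw [← Finset.insert_erase htP]
    refine Reach.step hR ⟨Finset.notMem_erase _ _, fun a ha => ?_, ?_⟩
    · have hat : co a t := ha.elim (hso a t) (hwr a t)
      refine Finset.mem_erase.2 ⟨?_, hP a t hat htP⟩
      rintro rfl
      exact irrefl_of co a hat
    · rintro a ha c hc hct ⟨x, hx, hw⟩
      rw [Finset.mem_erase] at ha hc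
      have hcP : c ∉ P := fun h => hc ⟨hct, h⟩
      rcases trichotomous_of co t c with h1 | h1 | h1
      · exact hmax a ha.2 (hax x a t c ha.1 hx hw h1)
      · exact hct h1.symm
      · exact hcP (hP c t h1 htP)

theorem serializable_iff_reach : h.Serializable ↔ h.Reach Finset.univ := by
  constructor
  · rintro ⟨co, hco, h1, h2, h3⟩
    exact Serializable.reach h1 h2 h3 _ (by simp)
  · intro hR
    obtain ⟨r, -, -, h3, h4, h5⟩ := hR.exists_rank
    have hinj : Function.Injective r := by simpa using h3
    refine ⟨fun a b => r a < r b, ?_, fun a b hab => h4 a b (Finset.mem_univ _) (Or.inl hab),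
      fun a b hab => h4 a b (Finset.mem_univ _) (Or.inr hab), fun x a t c hat hx hw htc =>
        h5 t (Finset.mem_univ _) a c ⟨x, hx, hw⟩ hat htc⟩
    exact { trichotomous := fun a b hab hba => hinj (by omega)
            irrefl := fun a => lt_irrefl _
            trans := fun a b c => lt_trans }

/-! ### The number of reachable prefixes -/

theorem Reach.so_closed {P : Finset (Fin h.size)} (hP : h.Reach P) {a b : Fin h.size}
    (hab : h.so a b = true) (hb : b ∈ P) : a ∈ P := by
  induction hP with
  | empty => simp at hb
  | @step P t _ ht ih =>
    rcases Finset.mem_insert.1 hb with rfl | hb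
    · exact Finset.mem_insert_of_mem (ht.2.1 a (Or.inl hab))
    · exact Finset.mem_insert_of_mem (ih hb)

variable (h) in
theorem size_pos : 0 < h.size := by
  obtain ⟨t, -⟩ := h.init
  exact t.pos

variable (h) in
theorem card_le_width (s : Finset (Fin h.size))
    (hs : IsAntichain (fun a b => h.so a b = true) (s : Set (Fin h.size))) :
    s.card ≤ h.width := by
  classical
  exact Finset.le_sup (f := Finset.card) (by simpa using hs)

variable (h) in
-- The maximal elements of `P` form an antichain and generate `P`. They are listed by a function on
-- `Fin h.width`, with repetitions if there are fewer; this padding needs `P` to be nonempty.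
theorem exists_generators (P : Finset (Fin h.size)) (hne : P.Nonempty)
    (hP : ∀ a b, h.so a b = true → b ∈ P → a ∈ P) :
    ∃ f : Fin h.width → Fin h.size, ∀ a, a ∈ P ↔ ∃ i, a = f i ∨ h.so a (f i) = true := by
  classical
  set m := P.filter fun a => ∀ b ∈ P, h.so a b = false with hm
  have hanti : IsAntichain (fun a b => h.so a b = true) (m : Set (Fin h.size)) := by
    intro a ha b hb _ hab
    have := (Finset.mem_filter.1 (Finset.mem_coe.1 ha)).2 b (Finset.mem_filter.1 hb).1
    simp_all
  -- Induction goes upwards in the session order, to a maximal element of `P` above a given one.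
  have hwf : WellFounded (fun a b => h.so b a = true) := by
    have : IsTrans (Fin h.size) (fun a b => h.so b a = true) :=
      ⟨fun a b c h1 h2 => h.so_trans c b a h2 h1⟩
    have : Std.Irrefl (fun a b : Fin h.size => h.so b a = true) :=
      ⟨fun a h1 => by simp [h.so_irrefl] at h1⟩
    exact Finite.wellFounded_of_trans_of_irrefl _
  have hbelow : ∀ a ∈ P, ∃ b ∈ m, a = b ∨ h.so a b = true := by
    intro a
    refine hwf.induction (C := fun a => a ∈ P → ∃ b ∈ m, a = b ∨ h.so a b = true) a ?_
    intro a ih ha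
    by_cases hmax : ∀ b ∈ P, h.so a b = false
    · exact ⟨a, Finset.mem_filter.2 ⟨ha, hmax⟩, Or.inl rfl⟩
    · push Not at hmax
      obtain ⟨b, hb, hab⟩ := hmax
      have hab : h.so a b = true := by simpa using hab
      obtain ⟨c, hc, hbc⟩ := ih b hab hb
      refine ⟨c, hc, Or.inr ?_⟩
      rcases hbc with rfl | hbc
      · exact hab
      · exact h.so_trans _ _ _ hab hbc
  obtain ⟨a₀, ha₀⟩ := hne
  obtain ⟨b₀, hb₀, -⟩ := hbelow a₀ ha₀
  have hcard := h.card_le_width m hanti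
  have : Nonempty m := ⟨⟨b₀, hb₀⟩⟩
  obtain ⟨e⟩ : Nonempty (m ↪ Fin h.width) :=
    Function.Embedding.nonempty_of_card_le (by simpa using hcard)
  refine ⟨fun i => (Function.invFun e i : m), fun a => ⟨fun ha => ?_, ?_⟩⟩
  · obtain ⟨b, hb, hab⟩ := hbelow a ha
    refine ⟨e ⟨b, hb⟩, ?_⟩
    simpa [Function.leftInverse_invFun e.injective ⟨b, hb⟩] using hab
  · rintro ⟨i, hi⟩
    have hmem := (Finset.mem_filter.1 (Function.invFun e i).2).1
    rcases hi with rfl | hi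
    · exact hmem
    · exact hP _ _ hi hmem

variable (h) in
-- A nonempty prefix can be recovered from its generators, so those inject into the functions from
-- `Fin h.width` to `Fin h.size`. The extra 1 is the empty prefix.
theorem card_prefixes_le (F : Finset (Finset (Fin h.size))) (hF : ∀ P ∈ F, h.Reach P) :
    F.card ≤ 1 + h.size ^ h.width := by
  classical
  have hex : ∀ P ∈ F.erase ∅, ∃ f : Fin h.width → Fin h.size,
      ∀ a, a ∈ P ↔ ∃ i, a = f i ∨ h.so a (f i) = true := fun P hP =>
    h.exists_generators P (Finset.nonempty_iff_ne_empty.2 (Finset.ne_of_mem_erase hP))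
      fun a b hab hb => (hF P (Finset.mem_of_mem_erase hP)).so_closed hab hb
  have : Nonempty (Fin h.width → Fin h.size) := ⟨fun _ => ⟨0, h.size_pos⟩⟩
  choose! g hg using hex
  have h1 : (F.erase ∅).card ≤ (Finset.univ : Finset (Fin h.width → Fin h.size)).card := by
    refine Finset.card_le_card_of_injOn g (fun _ _ => Finset.mem_coe.2 (Finset.mem_univ _)) ?_
    intro P hP Q hQ hPQ
    ext a
    rw [hg P hP a, hg Q hQ a, hPQ]
  have h2 : F.card - 1 ≤ (F.erase ∅).card := Finset.pred_card_le_card_erase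
  simp only [Finset.card_univ, Fintype.card_pi, Fintype.card_fin, Finset.prod_const] at h1
  omega

end History

/-! ### The layout of the input -/

theorem List.length_flatMap_range (f : ℕ → List ℕ) (k : ℕ) :
    ((List.range k).flatMap f).length = ∑ u ∈ Finset.range k, (f u).length := by
  induction k with
  | zero => simp
  | succ k ih => simp only [List.range_succ, List.flatMap_append, List.length_append, ih,
      Finset.sum_range_succ, List.flatMap_cons, List.flatMap_nil, List.append_nil]

theorem List.getD_flatMap_range (f : ℕ → List ℕ) {k a b : ℕ} (ha : a < k)
    (hb : b < (f a).length) :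
    ((List.range k).flatMap f).getD ((∑ u ∈ Finset.range a, (f u).length) + b) 0
      = (f a).getD b 0 := by
  induction k with
  | zero => omega
  | succ k ih =>
    simp only [List.range_succ, List.flatMap_append, List.flatMap_cons, List.flatMap_nil,
      List.append_nil]
    have hl := List.length_flatMap_range f k
    rcases Nat.lt_succ_iff_lt_or_eq.1 ha with h | rfl
    · rw [List.getD_append _ _ _ _ ?_, ih h]
      rw [hl]
      have : (∑ u ∈ Finset.range a, (f u).length) + (f a).length
          ≤ ∑ u ∈ Finset.range k, (f u).length := by
        rw [← Finset.sum_range_succ]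
        exact Finset.sum_le_sum_of_subset (Finset.range_mono h)
      omega
    · rw [List.getD_append_right _ _ _ _ (by omega), hl, Nat.add_sub_cancel_left]

theorem List.flatMap_finRange {n : ℕ} (f : Fin n → List ℕ) :
    (List.finRange n).flatMap f =
      (List.range n).flatMap fun a => if ha : a < n then f ⟨a, ha⟩ else [] := by
  rw [← List.map_coe_finRange_eq_range, List.flatMap_map]
  simp

namespace History

variable (h : History)

/-- The input cells. -/
def input (i : ℕ) : ℕ := h.encode.getD i 0

/-- The number of operations of the transaction with index `t`. -/
def opCount (t : ℕ) : ℕ := if ht : t < h.size then (h.ops ⟨t, ht⟩).length else 0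

/-- The address where the description of the transaction `t` starts. -/
def header (t : ℕ) : ℕ := 1 + h.size * h.size + ∑ u ∈ Finset.range t, (1 + 4 * h.opCount u)

/-- The address of the `i`-th operation of the transaction `t`. -/
def opAddr (t i : ℕ) : ℕ := h.header t + 1 + 4 * i

theorem length_encodeOp (t : Fin h.size) (i : Fin (h.ops t).length) :
    (h.encodeOp t i).length = 4 := by
  unfold encodeOp
  cases (h.ops t).get i <;> simp

/-- The part of the input that describes the transaction `t`. -/
def opCells (t : ℕ) : List ℕ :=
  if ht : t < h.size then
    (h.ops ⟨t, ht⟩).length ::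
      (List.finRange (h.ops ⟨t, ht⟩).length).flatMap (h.encodeOp ⟨t, ht⟩)
  else []

/-- A row of the matrix of the session order. -/
def soCells (a : ℕ) : List ℕ :=
  if ha : a < h.size then (List.finRange h.size).map fun b => (h.so ⟨a, ha⟩ b).toNat else []

theorem encode_eq : h.encode = h.size ::
    ((List.range h.size).flatMap h.soCells ++ (List.range h.size).flatMap h.opCells) := by
  unfold encode
  rw [List.flatMap_finRange, List.flatMap_finRange]
  rfl

theorem length_soCells {a : ℕ} (ha : a < h.size) : (h.soCells a).length = h.size := by
  simp [soCells, ha]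

theorem sum_length_soCells {k : ℕ} (hk : k ≤ h.size) :
    ∑ u ∈ Finset.range k, (h.soCells u).length = k * h.size := by
  rw [Finset.sum_congr rfl fun u hu => h.length_soCells (by rw [Finset.mem_range] at hu; omega)]
  simp

theorem length_ops_flatMap {t : Fin h.size} {k : ℕ} :
    ∀ u ∈ Finset.range k, u < (h.ops t).length →
      (if hu : u < (h.ops t).length then h.encodeOp t ⟨u, hu⟩ else []).length = 4 := by
  intro u _ hu
  simp [hu, length_encodeOp]

theorem length_opCells {t : ℕ} (ht : t < h.size) : (h.opCells t).length = 1 + 4 * h.opCount t := by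
  simp only [opCells, ht, dif_pos, List.length_cons, List.flatMap_finRange,
    List.length_flatMap_range, opCount]
  rw [Finset.sum_congr rfl fun u hu => h.length_ops_flatMap u hu (Finset.mem_range.1 hu)]
  simp; omega

theorem sum_length_opCells {k : ℕ} (hk : k ≤ h.size) :
    ∑ u ∈ Finset.range k, (h.opCells u).length = ∑ u ∈ Finset.range k, (1 + 4 * h.opCount u) :=
  Finset.sum_congr rfl fun u hu => h.length_opCells (by rw [Finset.mem_range] at hu; omega)

theorem length_encode :
    h.encode.length = 1 + h.size * h.size + ∑ u ∈ Finset.range h.size, (1 + 4 * h.opCount u) := by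
  rw [encode_eq, List.length_cons, List.length_append, List.length_flatMap_range,
    List.length_flatMap_range, sum_length_soCells _ le_rfl, sum_length_opCells _ le_rfl]
  omega

theorem input_zero : h.input 0 = h.size := by
  rw [input, encode_eq]; rfl

theorem input_so (a b : Fin h.size) : h.input (1 + (a * h.size + b)) = (h.so a b).toNat := by
  rw [input, encode_eq, Nat.add_comm 1, List.getD_cons_succ, List.getD_append,
    ← h.sum_length_soCells a.2.le, List.getD_flatMap_range _ a.2]
  · simp [soCells, List.getD_eq_getElem?_getD]
  · rw [h.length_soCells a.2]; exact b.2
  · rw [List.length_flatMap_range, sum_length_soCells _ le_rfl]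
    have : (a + 1) * h.size ≤ h.size * h.size := Nat.mul_le_mul_right _ a.2
    have := b.2
    nlinarith

theorem input_opCells (t k : ℕ) (ht : t < h.size) (hk : k < 1 + 4 * h.opCount t) :
    h.input (h.header t + k) = (h.opCells t).getD k 0 := by
  have e : h.header t + k = (((List.range h.size).flatMap h.soCells).length +
      ((∑ u ∈ Finset.range t, (h.opCells u).length) + k)) + 1 := by
    rw [List.length_flatMap_range, sum_length_soCells _ le_rfl, sum_length_opCells _ ht.le, header]
    omega
  rw [input, encode_eq, e, List.getD_cons_succ, List.getD_append_right _ _ _ _ (by omega),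
    Nat.add_sub_cancel_left, List.getD_flatMap_range _ ht]
  rwa [h.length_opCells ht]

theorem input_header {t : ℕ} (ht : t < h.size) : h.input (h.header t) = h.opCount t := by
  have := h.input_opCells t 0 ht (by omega)
  rw [Nat.add_zero] at this
  rw [this]
  simp [opCells, opCount, ht]

theorem input_op (t : Fin h.size) (i : Fin (h.ops t).length) {k : ℕ} (hk : k < 4) :
    h.input (h.opAddr t i + k) = (h.encodeOp t i).getD k 0 := by
  have hc : h.opCount t = (h.ops t).length := by simp [opCount]
  have hi := i.2
  have e : h.opAddr t i + k = h.header t + ((4 * i + k) + 1) := by rw [opAddr]; omega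
  rw [e, input_opCells _ _ _ t.2 (by omega)]
  simp only [opCells, t.2, dif_pos, List.getD_cons_succ, List.flatMap_finRange, Fin.eta]
  have hs : ∑ u ∈ Finset.range i,
      (if hu : u < (h.ops t).length then h.encodeOp t ⟨u, hu⟩ else []).length = 4 * i := by
    rw [Finset.sum_congr rfl fun u hu =>
      h.length_ops_flatMap (t := t) u hu (by rw [Finset.mem_range] at hu; omega)]
    simp [mul_comm]
  rw [← hs, List.getD_flatMap_range (fun u => if hu : u < (h.ops t).length then
    h.encodeOp t ⟨u, hu⟩ else []) hi]
  · simp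
  · simpa [length_encodeOp] using hk

variable {h}

theorem input_read {t : Fin h.size} {i : Fin (h.ops t).length} {x v : ℕ} {a : Fin h.size}
    (ho : (h.ops t).get i = Op.read x v) (hs : h.src t i = some a) :
    h.input (h.opAddr t i) = 0 ∧ h.input (h.opAddr t i + 1) = x ∧
      h.input (h.opAddr t i + 3) = a + 1 := by
  have h0 := h.input_op t i (k := 0) (by omega)
  have h1 := h.input_op t i (k := 1) (by omega)
  have h3 := h.input_op t i (k := 3) (by omega)
  simp only [encodeOp, ho, hs] at h0 h1 h3
  exact ⟨h0, h1, h3⟩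

theorem input_write {t : Fin h.size} {i : Fin (h.ops t).length} {x v : ℕ}
    (ho : (h.ops t).get i = Op.write x v) :
    h.input (h.opAddr t i) = 1 ∧ h.input (h.opAddr t i + 1) = x := by
  have h0 := h.input_op t i (k := 0) (by omega)
  have h1 := h.input_op t i (k := 1) (by omega)
  simp only [encodeOp, ho] at h0 h1
  exact ⟨h0, h1⟩

theorem input_eq_zero_iff (t : Fin h.size) (i : Fin (h.ops t).length) :
    h.input (h.opAddr t i) = 0 ↔
      ∃ a, ∃ v, (h.ops t).get i = Op.read (h.input (h.opAddr t i + 1)) v ∧ h.src t i = some a ∧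
        h.input (h.opAddr t i + 3) = a + 1 := by
  cases ho : (h.ops t).get i with
  | read x v =>
    obtain ⟨a, ha, -⟩ := h.src_read t i x v ho
    obtain ⟨h0, h1, h3⟩ := input_read ho ha
    simp only [h0, h1, true_iff]
    exact ⟨a, v, rfl, ha, h3⟩
  | write x v => simp [(input_write ho).1]

theorem input_eq_one_iff (t : Fin h.size) (i : Fin (h.ops t).length) :
    h.input (h.opAddr t i) = 1 ↔
      ∃ v, (h.ops t).get i = Op.write (h.input (h.opAddr t i + 1)) v := by
  cases ho : (h.ops t).get i with
  | read x v =>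
    obtain ⟨a, ha, -⟩ := h.src_read t i x v ho
    simp [(input_read ho ha).1]
  | write x v => simp [input_write ho]

variable (h) in
/-- Some read in `t` that satisfies `φ` on its variable yields the index `q` of a pair of
transactions. -/
def ReadAt (φ : ℕ → Prop) (q : ℕ) : Prop :=
  ∃ t < h.size, ∃ i < h.opCount t, h.input (h.opAddr t i) = 0 ∧ φ (h.input (h.opAddr t i + 1)) ∧
    q = (h.input (h.opAddr t i + 3) - 1) * h.size + t

variable (h) in
/-- The transaction `u` writes `x`, read off from the input. -/
def WriteAt (u x : ℕ) : Prop :=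
  ∃ i < h.opCount u, h.input (h.opAddr u i) = 1 ∧ h.input (h.opAddr u i + 1) = x

/-- Keeps the lookup of `source * size` inside the table of multiples, which is only specified below
`size`; the subtraction undoes the shift by one in the encoding of sources. -/
theorem src_lt {t i : ℕ} (ht : t < h.size) (hi : i < h.opCount t)
    (h0 : h.input (h.opAddr t i) = 0) : h.input (h.opAddr t i + 3) - 1 < h.size := by
  have hc : i < (h.ops ⟨t, ht⟩).length := by simpa [opCount, ht] using hi
  obtain ⟨a, v, -, -, h3⟩ := (input_eq_zero_iff ⟨t, ht⟩ ⟨i, hc⟩).1 h0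
  simp only at h3
  omega

/-- The index `a * size + c` determines the pair because `c < size`. A trivial `φ` gives the
write-read relation; being written by `t` gives the conflicts of `t`. -/
theorem readAt_iff (φ : ℕ → Prop) (a c : Fin h.size) :
    h.ReadAt φ (a * h.size + c) ↔ ∃ x, φ x ∧ h.wrOn x a c := by
  constructor
  · rintro ⟨t, ht, i, hi, h0, hφ, hq⟩
    have hc : i < (h.ops ⟨t, ht⟩).length := by simpa [opCount, ht] using hi
    obtain ⟨a', v, ho, hs, h3⟩ := (input_eq_zero_iff ⟨t, ht⟩ ⟨i, hc⟩).1 h0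
    simp only at h3 ho
    rw [h3, Nat.add_sub_cancel] at hq
    have e1 : (c : ℕ) = t := by
      have := congrArg (· % h.size) hq
      simpa [Nat.mul_add_mod_of_lt, ht, Nat.add_mod, Nat.mod_eq_of_lt] using this
    have e2 : a = a' := by
      rw [e1] at hq
      exact Fin.ext (Nat.eq_of_mul_eq_mul_right h.size_pos (by omega))
    obtain rfl : c = ⟨t, ht⟩ := Fin.ext e1
    subst e2
    exact ⟨_, hφ, ⟨i, hc⟩, v, ho, hs⟩
  · rintro ⟨x, hφ, i, v, ho, hs⟩
    obtain ⟨h0, h1, h3⟩ := input_read ho hs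
    refine ⟨c, c.2, i, by simp [opCount], h0, h1 ▸ hφ, ?_⟩
    rw [h3]; simp

theorem writeAt_iff (u : Fin h.size) (x : ℕ) : h.WriteAt u x ↔ h.Writes u x := by
  constructor
  · rintro ⟨i, hi, h1, hx⟩
    have hc : i < (h.ops u).length := by simpa [opCount] using hi
    obtain ⟨v, hv⟩ := (input_eq_one_iff u ⟨i, hc⟩).1 h1
    simp only [hx] at hv
    exact ⟨v, hv ▸ List.get_mem _ _⟩
  · rintro ⟨v, hv⟩
    obtain ⟨i, hi⟩ := List.get_of_mem hv
    have := input_write hi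
    exact ⟨i, by simp [opCount], this⟩

end History

/-! ### The logarithmic cost model -/

namespace Prog

/-- A bound on the number of bits of the constants in a program. -/
def litSize : Prog → ℕ
  | instr (.const _ c) => c.size
  | instr _ => 0
  | seq p q => max p.litSize q.litSize
  | ite _ p q => max p.litSize q.litSize
  | loop _ p => p.litSize

end Prog

/-- All values in the memory have at most `L` bits. -/
def RamState.Fits (s : RamState) (L : ℕ) : Prop :=
  (∀ x, (s.reg x).size ≤ L) ∧ ∀ a i, (s.arr a i).size ≤ L

theorem Nat.size_add_le {x y L : ℕ} (hx : x.size ≤ L) (hy : y.size ≤ L) :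
    (x + y).size ≤ L + 1 := by
  rw [Nat.size_le] at *
  rw [pow_succ]; omega

theorem RamState.Fits.mono {s : RamState} {L L' : ℕ} (h : s.Fits L) (hL : L ≤ L') : s.Fits L' :=
  ⟨fun x => (h.1 x).trans hL, fun a i => (h.2 a i).trans hL⟩

/-- Only addition can make a number longer than its operands, and by at most one bit; constants are
covered by `litSize`. The bound is for every `L`, so that the second half of a run can start from `L
+ t`. -/
theorem Exec.bits_le {p : Prog} {s s' : RamState} {t b : ℕ} (h : Exec p s t b s') :
    ∀ L, s.Fits L → p.litSize ≤ L → s'.Fits (L + t) ∧ b ≤ t * (1 + 2 * (L + t)) := by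
  induction h with
  | instr i s =>
    intro L hL hp
    have reg : ∀ x v, v.size ≤ L + 1 →
        RamState.Fits { s with reg := Function.update s.reg x v } (L + 1) := by
      intro x v hv
      refine ⟨fun y => ?_, fun a i => (hL.2 a i).trans (by omega)⟩
      have := hL.1 y
      simp only [Function.update_apply]
      split_ifs <;> omega
    cases i with
    | const x c =>
      simp only [Prog.litSize] at hp
      exact ⟨reg x c (by omega), by simp only [Instr.bitCost]; omega⟩
    | add x y z =>
      have hy := hL.1 y
      have hz := hL.1 z
      exact ⟨reg x _ (Nat.size_add_le hy hz), by simp only [Instr.bitCost]; omega⟩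
    | sub x y z =>
      have hy := hL.1 y
      have hz := hL.1 z
      exact ⟨reg x _ ((Nat.size_le_size (Nat.sub_le _ _)).trans (by omega)),
        by simp only [Instr.bitCost]; omega⟩
    | load x a y =>
      have hy := hL.1 y
      have hz := hL.2 a (s.reg y)
      exact ⟨reg x _ (by omega), by simp only [Instr.bitCost]; omega⟩
    | store a x y =>
      have hx := hL.1 x
      have hy := hL.1 y
      refine ⟨⟨fun y => (hL.1 y).trans (by omega), fun c i => ?_⟩,
        by simp only [Instr.bitCost]; omega⟩
      have := hL.2 c i
      have := hL.2 a i
      simp only [Instr.run, Function.update_apply]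
      split_ifs with h1
      · simp only [Function.update_apply]
        split_ifs <;> omega
      · omega
  | @seq p q s s' s'' t b t' b' _ _ ih ih' =>
    intro L hL hp
    simp only [Prog.litSize, max_le_iff] at hp
    obtain ⟨f1, b1⟩ := ih L hL hp.1
    obtain ⟨f2, b2⟩ := ih' (L + t) f1 (by omega)
    exact ⟨f2.mono (by omega), by nlinarith⟩
  | @ite_true x p q s s' t b _ _ ih =>
    intro L hL hp
    simp only [Prog.litSize, max_le_iff] at hp
    obtain ⟨f1, b1⟩ := ih L hL hp.1
    have := hL.1 x
    exact ⟨f1.mono (by omega), by nlinarith⟩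
  | @ite_false x p q s s' t b _ _ ih =>
    intro L hL hp
    simp only [Prog.litSize, max_le_iff] at hp
    obtain ⟨f1, b1⟩ := ih L hL hp.2
    have := hL.1 x
    exact ⟨f1.mono (by omega), by nlinarith⟩
  | @loop_done x p s _ =>
    intro L hL _
    have := hL.1 x
    exact ⟨hL.mono (by omega), by omega⟩
  | @loop_next x p s s' s'' t b t' b' _ _ _ ih ih' =>
    intro L hL hp
    obtain ⟨f1, b1⟩ := ih L hL hp
    obtain ⟨f2, b2⟩ := ih' (L + t) f1 (hp.trans (by omega))
    have := hL.1 x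
    exact ⟨f2.mono (by omega), by nlinarith⟩

theorem size_le_bitLength {l : List ℕ} {v : ℕ} (hv : v ∈ l) : v.size ≤ bitLength l := by
  have := List.single_le_sum (l := l.map fun v => 1 + v.size) (by simp) _
    (List.mem_map_of_mem hv)
  unfold bitLength
  omega

theorem length_le_bitLength (l : List ℕ) : l.length ≤ bitLength l := by
  induction l with
  | nil => simp
  | cons a l ih => simp only [bitLength, List.map_cons, List.sum_cons, List.length_cons] at *; omega

theorem fits_ofInput (l : List ℕ) : (RamState.ofInput l).Fits (bitLength l) := by
  refine ⟨fun x => by simp [RamState.ofInput], fun a i => ?_⟩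
  simp only [RamState.ofInput]
  split_ifs
  · by_cases hi : i < l.length
    · rw [List.getD_eq_getElem _ _ hi]
      exact size_le_bitLength (List.getElem_mem hi)
    · rw [List.getD_eq_default _ _ (by omega)]; simp
  · simp

/-! ### The preprocessing

Variables: `0` answer, `1` number `n` of transactions, `2` and `11` loop counters, `3` its square,
`4` the number `2 ^ n`, `5` row, `6` column, `7` input position, `8` number of operations,
`9` current transaction, `10` its offset in the table of conflicts, `12` head and `13` tail of the
queue, `14` current prefix, `15` its undecoded rest, `16` pair of transactions, `17` number of
operations of a transaction.

Arrays: `0` input, `1` multiples of `n`, `2` powers of two, `3` rows and `4` columns of pairs,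
`5` positions and `6` transactions of the operations, `7` last transaction found to write a
variable, `8` conflicts, `9` write-read relation, `10` prefixes found, `11` queue, `12` members of
the current prefix, `13` flag. -/

namespace Checker

open Stm Ex

/-- Multiples of `n` and powers of two. -/
def tables : Stm :=
  .set 4 (lit 1) ;;
  upTo 2 1 (put 1 (var 2) (var 3) ;; put 2 (var 2) (var 4) ;;
    .set 3 (.add (var 3) (var 1)) ;; .set 4 (.add (var 4) (var 4)))

/-- Rows and columns of the pairs of transactions. -/
def pairs : Stm :=
  upTo 16 3 (put 3 (var 16) (var 5) ;; put 4 (var 16) (var 6) ;;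
    .ite (.sub (var 1) (.add (var 6) (lit 1)))
      (.set 6 (.add (var 6) (lit 1)))
      (.set 6 (lit 0) ;; .set 5 (.add (var 5) (lit 1))))

/-- Positions and transactions of the operations. -/
def scan : Stm :=
  .set 7 (.add (lit 1) (var 3)) ;;
  upTo 9 1 (.set 17 (get 0 (var 7)) ;; .set 7 (.add (var 7) (lit 1)) ;;
    upTo 11 17 (put 5 (var 8) (var 7) ;; put 6 (var 8) (var 9) ;;
      .set 7 (.add (var 7) (lit 4)) ;; .set 8 (.add (var 8) (lit 1))))

/-- The kind of the current operation. -/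
def kind : Ex := get 0 (get 5 (var 11))

/-- The variable of the current operation. -/
def target : Ex := get 0 (.add (get 5 (var 11)) (lit 1))

/-- The pair formed by the source and the transaction of the current operation. -/
def edge : Ex :=
  .add (get 1 (.sub (get 0 (.add (get 5 (var 11)) (lit 3))) (lit 1))) (get 6 (var 11))

/-- The write-read relation. -/
def markReads : Stm := mark 11 8 9 (.not kind) edge (lit 1)

/-- The table of conflicts. -/
def markConflicts : Stm :=
  upTo 9 1 (
    mark 11 8 7 (.and (.eq (get 6 (var 11)) (var 9)) (.eq kind (lit 1))) target
      (.add (var 9) (lit 1)) ;;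
    mark 11 8 8 (.and (.not kind) (.eq (get 7 target) (.add (var 9) (lit 1))))
      (.add (var 10) edge) (lit 1) ;;
    .set 10 (.add (var 10) (var 3)))

/-- All tables that the search uses. -/
def preprocess : Stm :=
  .set 1 (get 0 (lit 0)) ;; tables ;; pairs ;; scan ;; markReads ;; markConflicts

/-! ### Correctness of the preprocessing -/

/-- The machine cannot multiply, so multiples and powers are produced by repeated addition and
doubling. -/
theorem tables_ok {s : RamState} {n : ℕ} (hn : s.reg 1 = n) (h3 : s.reg 3 = 0) :
    Ok tables s (12 + n * 40) (fun s' => s'.reg 3 = n * n ∧ s'.reg 4 = 2 ^ n ∧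
      (∀ i < n, s'.arr 1 i = i * n) ∧ ∀ i < n, s'.arr 2 i = 2 ^ i) := by
  refine ((Ok.set 4 (lit 1)).seq (fun s₁ _ hs₁ => Ok.upTo_const (n := n)
    (fun k s => s.reg 3 = k * n ∧ s.reg 4 = 2 ^ k ∧ (∀ i < k, s.arr 1 i = i * n) ∧
      ∀ i < k, s.arr 2 i = 2 ^ i) 28 ?_ rfl rfl (by decide) ?_ ?_)).mono ?_
      fun s' _ h => h.2
  · subst hs₁; simpa using hn
  · subst hs₁; simpa using h3
  · rintro k hk s hk2 hF ⟨i3, i4, i1, i2⟩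
    have e1 : s.reg 1 = n := by rw [hF.1 1 rfl, hs₁]; simpa using hn
    refine Ok.of_flat rfl (by decide) fun _ => ?_
    simp only [run, RamState.setReg_reg, RamState.setReg_arr, RamState.setArr_reg,
      RamState.setArr_arr_apply, Ex.val, hk2, i3, i4, e1]
    refine ⟨by simp; ring, by simp; ring, fun i hi => ?_, fun i hi => ?_⟩
    · by_cases hik : i = k
      · simp [hik]
      · simpa [hik] using i1 i (by omega)
    · by_cases hik : i = k
      · simp [hik]
      · simpa [hik] using i2 i (by omega)
  · simp only [Ex.cost]; omega

/-- In place of division, row and column advance like an odometer: the column returns to zero after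
`n - 1`, and the row then increases. -/
theorem pairs_ok {s : RamState} {n : ℕ} (hn : s.reg 1 = n) (h3 : s.reg 3 = n * n)
    (h5 : s.reg 5 = 0) (h6 : s.reg 6 = 0) (hpos : 0 < n) :
    Ok pairs s (9 + n * n * 60) (fun s' =>
      (∀ q < n * n, s'.arr 3 q = q / n) ∧ ∀ q < n * n, s'.arr 4 q = q % n) := by
  refine (Ok.upTo_const (n := n * n)
    (fun k s => s.reg 5 = k / n ∧ s.reg 6 = k % n ∧ (∀ q < k, s.arr 3 q = q / n) ∧
      ∀ q < k, s.arr 4 q = q % n) 48 h3 rfl rfl (by decide) ?_ ?_).mono le_rfl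
      fun s' _ h => h.2.2.2
  · simp [h5, h6]
  · rintro k hk s hkq hF ⟨i5, i6, i3, i4⟩
    have e1 : s.reg 1 = n := by rw [hF.1 1 rfl]; exact hn
    refine Ok.of_flat rfl (by decide) fun _ => ?_
    have hlt := Nat.mod_lt k hpos
    have hdm := Nat.div_add_mod k n
    by_cases hc : n - (k % n + 1) = 0
    · have hkn : k % n + 1 = n := by omega
      have hk1 : k + 1 = n * (k / n + 1) := by rw [mul_add]; omega
      have e5 : (k + 1) / n = k / n + 1 := by rw [hk1, Nat.mul_div_cancel_left _ hpos]
      have e6 : (k + 1) % n = 0 := by rw [hk1, Nat.mul_mod_right]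
      simp [run, i5, i6, e1, hkq, hc, e5, e6]
      refine ⟨fun i hi => ?_, fun i hi => ?_⟩ <;>
      · by_cases hik : i = k
        · simp [hik]
        · have : i < k := by omega
          simp [hik, i3, i4, this]
    · have e5 : (k + 1) / n = k / n := by
        rw [Nat.div_eq_iff hpos]
        constructor
        · rw [mul_comm]; omega
        · rw [mul_comm]; omega
      have e6 : (k + 1) % n = k % n + 1 := by
        have := Nat.div_add_mod (k + 1) n
        rw [e5] at this; omega
      simp [run, i5, i6, e1, hkq, hc, e5, e6]
      refine ⟨fun i hi => ?_, fun i hi => ?_⟩ <;>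
      · by_cases hik : i = k
        · simp [hik]
        · have : i < k := by omega
          simp [hik, i3, i4, this]

variable {h : History} {s : RamState}

/-- The arrays `5` and `6` list the operations of the history. -/
def Scanned (h : History) (s : RamState) : Prop :=
  s.reg 8 = ∑ u ∈ Finset.range h.size, h.opCount u ∧
    ∀ a u, (∃ j < s.reg 8, s.arr 5 j = a ∧ s.arr 6 j = u) ↔
      u < h.size ∧ ∃ i < h.opCount u, a = h.opAddr u i

/-- Listing the operations consecutively lets later passes be single loops. The time of a round
depends on the number of operations of its transaction, so the bound is a sum and stays linear in
the input. -/
theorem scan_ok (h0 : s.arr 0 = h.input) (hn : s.reg 1 = h.size)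
    (h3 : s.reg 3 = h.size * h.size) (h8 : s.reg 8 = 0) :
    Ok scan s (20 + ∑ u ∈ Finset.range h.size, (40 + h.opCount u * 50)) (Scanned h) := by
  refine ((Ok.set 7 _).seq (fun s₁ hF₁ hs₁ => Ok.upTo (n := h.size)
    (fun k s => s.reg 7 = h.header k ∧ s.reg 8 = ∑ u ∈ Finset.range k, h.opCount u ∧
      ∀ a u, (∃ j < ∑ u ∈ Finset.range k, h.opCount u, s.arr 5 j = a ∧ s.arr 6 j = u) ↔
      u < k ∧ ∃ i < h.opCount u, a = h.opAddr u i)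
      (fun u => 28 + h.opCount u * 50) ?_ rfl rfl (by decide) ?_ ?_)).mono ?_
      fun s' _ h => ?_
  · subst hs₁; simpa using hn
  · subst hs₁; simp [History.header, h3, h8]
  · rintro t ht s₂ h9 hF ⟨i7, i8, i56⟩
    have e0 : s₂.arr 0 = h.input := by rw [hF.2 0 rfl, hF₁.2 0 rfl, h0]
    refine ((Ok.set 17 _).seq fun s₃ hF₃ hs₃ => (Ok.set 7 _).seq fun s₄ hF₄ hs₄ =>
      Ok.upTo_const (n := h.opCount t)
      (fun i s => s.reg 7 = h.opAddr t i ∧ s.reg 8 = ∑ u ∈ Finset.range t, h.opCount u + i ∧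
        ∀ a u, (∃ j < ∑ u ∈ Finset.range t, h.opCount u + i, s.arr 5 j = a ∧ s.arr 6 j = u) ↔
          (u < t ∧ ∃ i < h.opCount u, a = h.opAddr u i) ∨ (u = t ∧ ∃ i' < i, a = h.opAddr t i'))
      38 ?_ rfl rfl (by decide) ?_ ?_).mono ?_ ?_
    · simp [hs₄, hs₃, e0, i7, h.input_header ht]
    · simp [hs₄, hs₃, i7, i8, i56, History.opAddr]
    · rintro i hi s₅ h11 hF₅ ⟨j7, j8, j56⟩
      have e9 : s₅.reg 9 = t := by rw [hF₅.1 9 rfl, hF₄.1 9 rfl, hF₃.1 9 rfl, h9]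
      refine Ok.of_flat rfl (by decide) fun _ => ?_
      simp [run, j7, j8, e9]
      refine ⟨by simp [History.opAddr]; omega, by omega, fun a u => ?_⟩
      generalize ∑ u ∈ Finset.range t, h.opCount u = S at *
      have hsplit : (∃ j < S + (i + 1), (if j = S + i then h.opAddr t i else s₅.arr 5 j) = a ∧
          (if j = S + i then t else s₅.arr 6 j) = u) ↔
          (∃ j < S + i, s₅.arr 5 j = a ∧ s₅.arr 6 j = u) ∨ (h.opAddr t i = a ∧ t = u) := by
        constructor
        · rintro ⟨j, hj, hj'⟩
          by_cases hji : j = S + i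
          · right; simpa [hji] using hj'
          · left; exact ⟨j, by omega, by simpa [hji] using hj'⟩
        · rintro (⟨j, hj, hj'⟩ | hj)
          · exact ⟨j, by omega, by simpa [show j ≠ S + i by omega] using hj'⟩
          · exact ⟨S + i, by omega, by simpa using hj⟩
      rw [hsplit, j56, or_assoc]
      refine or_congr_right ⟨?_, ?_⟩
      · rintro (⟨rfl, i', hi', rfl⟩ | ⟨rfl, rfl⟩)
        · exact ⟨rfl, i', by omega, rfl⟩
        · exact ⟨rfl, i, by omega, rfl⟩
      · rintro ⟨rfl, i', hi', rfl⟩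
        by_cases hii : i' = i
        · right; simp [hii]
        · left; exact ⟨rfl, i', by omega, rfl⟩
    · simp only [Ex.cost]; omega
    · rintro s₅ - ⟨-, j7, j8, j56⟩
      simp only [RamState.setReg_reg, RamState.setReg_arr]
      simp only [j7, j8, Finset.sum_range_succ, j56]
      refine ⟨by simp [History.header, History.opAddr, Finset.sum_range_succ]; omega,
        by simp, fun a u => ⟨?_, ?_⟩⟩
      · rintro (⟨hu, h'⟩ | ⟨rfl, h'⟩)
        · exact ⟨by omega, h'⟩
        · exact ⟨by omega, h'⟩
      · rintro ⟨hu, h'⟩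
        by_cases hut : u = t
        · subst hut; exact Or.inr ⟨rfl, h'⟩
        · exact Or.inl ⟨by omega, h'⟩
  · simp only [Ex.cost, Finset.sum_add_distrib, Finset.sum_const, Finset.card_range, smul_eq_mul]
    omega
  · obtain ⟨-, -, h8, h56⟩ := h
    refine ⟨h8, ?_⟩
    rw [h8]; exact h56

end Checker

namespace Checker

open Stm Ex

variable {h : History} {s : RamState}

/-- Translates a search through the list of operations into one over transactions and positions. -/
theorem Scanned.exists_iff (hs : Scanned h s) (φ : ℕ → ℕ → Prop) :
    (∃ k < s.reg 8, φ (s.arr 5 k) (s.arr 6 k)) ↔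
      ∃ u < h.size, ∃ i < h.opCount u, φ (h.opAddr u i) u := by
  constructor
  · rintro ⟨k, hk, hφ⟩
    obtain ⟨hu, i, hi, ha⟩ := (hs.2 _ _).1 ⟨k, hk, rfl, rfl⟩
    exact ⟨_, hu, i, hi, ha ▸ hφ⟩
  · rintro ⟨u, hu, i, hi, hφ⟩
    obtain ⟨k, hk, ha, hb⟩ := (hs.2 _ _).2 ⟨hu, i, hi, rfl⟩
    exact ⟨k, hk, by rwa [ha, hb]⟩

theorem Scanned.src_lt (hs : Scanned h s) {k : ℕ} (hk : k < s.reg 8)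
    (h0 : h.input (s.arr 5 k) = 0) : h.input (s.arr 5 k + 3) - 1 < h.size := by
  obtain ⟨hu, i, hi, ha⟩ := (hs.2 _ _).1 ⟨k, hk, rfl, rfl⟩
  rw [ha] at h0 ⊢
  exact History.src_lt hu hi h0

/-- The input, its size, and the list of operations. -/
structure Prepared (h : History) (s : RamState) : Prop where
  input : s.arr 0 = h.input
  size : s.reg 1 = h.size
  sq : s.reg 3 = h.size * h.size
  mul : ∀ i < h.size, s.arr 1 i = i * h.size
  scanned : Scanned h s

theorem Prepared.of_eq {s' : RamState} (hs : Prepared h s) (h1 : s'.reg 1 = s.reg 1)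
    (h3 : s'.reg 3 = s.reg 3) (h8 : s'.reg 8 = s.reg 8) (a0 : s'.arr 0 = s.arr 0)
    (a1 : s'.arr 1 = s.arr 1) (a5 : s'.arr 5 = s.arr 5) (a6 : s'.arr 6 = s.arr 6) :
    Prepared h s' := by
  obtain ⟨i1, i2, i3, i4, i5, i6⟩ := hs
  exact ⟨by rw [a0, i1], by rw [h1, i2], by rw [h3, i3], by rw [a1]; exact i4,
    by rw [h8, i5], by rw [h8, a5, a6]; exact i6⟩

theorem Prepared.edge_val {s' : RamState} (hs : Prepared h s) {k : ℕ} (hk : k < s.reg 8)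
    (h11 : s'.reg 11 = k) (a0 : s'.arr 0 = s.arr 0) (a1 : s'.arr 1 = s.arr 1)
    (a5 : s'.arr 5 = s.arr 5) (a6 : s'.arr 6 = s.arr 6) (h0 : h.input (s.arr 5 k) = 0) :
    edge.val s' = (h.input (s.arr 5 k + 3) - 1) * h.size + s.arr 6 k := by
  simp only [edge, Ex.val, h11, a0, a1, a5, a6, hs.input]
  rw [hs.mul _ (hs.scanned.src_lt hk h0)]

theorem markReads_ok (hs : Prepared h s) (h9 : ∀ x, s.arr 9 x = 0) :
    Ok markReads s (9 + s.reg 8 * 60)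
      (fun s' => ∀ q, s'.arr 9 q ≠ 0 ↔ h.ReadAt (fun _ => True) q) := by
  refine (Ok.mark (V := 1) (n := s.reg 8) (T := 48) (fun k => h.input (s.arr 5 k) = 0)
    (fun k => (h.input (s.arr 5 k + 3) - 1) * h.size + s.arr 6 k)
    rfl (by decide) (by decide) (by decide) (by decide) ?_).mono le_rfl ?_
  · intro k hk s' h11 hr ha
    refine ⟨?_, fun h0 => hs.edge_val hk h11 (ha 0 (by decide)) (ha 1 (by decide))
      (ha 5 (by decide)) (ha 6 (by decide)) h0, rfl⟩
    simp [kind, h11, ha 0, ha 5, hs.input]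
  · intro s' _ hs' q
    have := hs.scanned.exists_iff fun a u => h.input a = 0 ∧
      (h.input (a + 3) - 1) * h.size + u = q
    have h1 : (∃ u < h.size, ∃ i < h.opCount u, h.input (h.opAddr u i) = 0 ∧
        (h.input (h.opAddr u i + 3) - 1) * h.size + u = q) ↔ h.ReadAt (fun _ => True) q := by
      simp only [History.ReadAt, true_and, eq_comm (a := q)]
    obtain ⟨h2, h3⟩ := hs' q _ (this.trans h1)
    rw [h9] at h3
    by_cases hq : h.ReadAt (fun _ => True) q
    · simp [hq, h2 hq]
    · simp [hq, h3 hq]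

/-- For each `t`, a first pass stamps the variables written by `t` with `t + 1`, and a second pass
records the reads of stamped variables. Earlier stamps are at most `t`, so the array is never
cleared; the shift by one separates stamps from the initial zeros. -/
theorem markConflicts_ok (hs : Prepared h s) (h7 : ∀ x, s.arr 7 x = 0) (h8 : ∀ x, s.arr 8 x = 0)
    (h10 : s.reg 10 = 0) :
    Ok markConflicts s (9 + h.size * (60 + s.reg 8 * 300))
      (fun s' => ∀ x, s'.arr 8 x ≠ 0 ↔
        ∃ u < h.size, ∃ q, x = u * (h.size * h.size) + q ∧ h.ReadAt (h.WriteAt u) q) := by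
  have hbase : ∀ s', Frame markConflicts s s' → Prepared h s' := fun s' hF =>
    hs.of_eq (hF.1 1 rfl) (hF.1 3 rfl) (hF.1 8 rfl) (hF.2 0 rfl) (hF.2 1 rfl) (hF.2 5 rfl)
      (hF.2 6 rfl)
  refine (Ok.upTo_const (n := h.size) (fun t s => s.reg 10 = t * (h.size * h.size) ∧
      (∀ x, s.arr 7 x ≤ t) ∧ ∀ x, s.arr 8 x ≠ 0 ↔
        ∃ u < t, ∃ q, x = u * (h.size * h.size) + q ∧ h.ReadAt (h.WriteAt u) q)
    (48 + s.reg 8 * 300) hs.size rfl rfl (by decide) ?_ ?_).mono ?_ fun _ _ h => h.2.2.2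
  · simp [h10, h7, h8]
  · rintro t ht s₁ h9 hF₁ ⟨i10, i7, i8⟩
    have b₁ := hbase s₁ hF₁
    have hM : s₁.reg 8 = s.reg 8 := hF₁.1 8 rfl
    refine ((Ok.mark (V := t + 1) (n := s.reg 8) (T := 120)
        (fun k => s₁.arr 6 k = t ∧ h.input (s₁.arr 5 k) = 1) (fun k => h.input (s₁.arr 5 k + 1))
        hM (by decide) (by decide) (by decide) (by decide) ?_).seq
      fun s₂ hF₂ hs₂ => ((Ok.mark (V := 1) (n := s.reg 8) (T := 120)
        (fun k => h.input (s₂.arr 5 k) = 0 ∧ s₂.arr 7 (h.input (s₂.arr 5 k + 1)) = t + 1)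
        (fun k => t * (h.size * h.size) + ((h.input (s₂.arr 5 k + 3) - 1) * h.size + s₂.arr 6 k))
        ((hF₂.1 8 rfl).trans hM) (by decide) (by decide) (by decide) (by decide) ?_)).seq
      fun s₃ hF₃ hs₃ => Ok.of_flat (T := 8) rfl (by decide) ?_).mono ?_ fun _ _ h => h
    · intro k hk s' h11 hr ha
      have e9 : s'.reg 9 = t := (hr 9 (by decide) (by decide)).trans h9
      simp only [target, kind, Ex.val, Ex.val_and_eq_zero, Ex.val_eq_eq_zero, h11, ha 0 (by decide),
        ha 5 (by decide), ha 6 (by decide), b₁.input, e9]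
      simp only [implies_true, and_true]
      tauto
    · have b₂ := b₁.of_eq (hF₂.1 1 rfl) (hF₂.1 3 rfl) (hF₂.1 8 rfl) (hF₂.2 0 rfl) (hF₂.2 1 rfl)
        (hF₂.2 5 rfl) (hF₂.2 6 rfl)
      intro k hk s' h11 hr ha
      have e9 : s'.reg 9 = t := by rw [hr 9 (by decide) (by decide), hF₂.1 9 rfl, h9]
      have e10 : s'.reg 10 = t * (h.size * h.size) := by
        rw [hr 10 (by decide) (by decide), hF₂.1 10 rfl, i10]
      have hk' : k < s₂.reg 8 := by rw [hF₂.1 8 rfl, hM]; exact hk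
      refine ⟨?_, fun h0 => ?_, rfl⟩
      · simp only [target, kind, Ex.val, Ex.val_and_eq_zero, Ex.val_eq_eq_zero, h11,
          Ex.val_not_eq_zero, ha 0 (by decide), ha 5 (by decide), ha 7 (by decide), b₂.input, e9]
        tauto
      · rw [Ex.val, Ex.val, e10, b₂.edge_val hk' h11 (ha 0 (by decide)) (ha 1 (by decide))
          (ha 5 (by decide)) (ha 6 (by decide)) h0.1]
    · intro _
      have e10 : s₃.reg 10 = t * (h.size * h.size) := by rw [hF₃.1 10 rfl, hF₂.1 10 rfl, i10]
      have e3 : s₃.reg 3 = h.size * h.size := by rw [hF₃.1 3 rfl, hF₂.1 3 rfl, b₁.sq]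
      have a5 : s₂.arr 5 = s₁.arr 5 := hF₂.2 5 rfl
      have a6 : s₂.arr 6 = s₁.arr 6 := hF₂.2 6 rfl
      have a7 : s₃.arr 7 = s₂.arr 7 := hF₃.2 7 rfl
      have a8 : s₂.arr 8 = s₁.arr 8 := hF₂.2 8 rfl
      have hW : ∀ x, s₂.arr 7 x = t + 1 ↔ h.WriteAt t x := by
        intro x
        have h1 := b₁.scanned.exists_iff fun a u => (u = t ∧ h.input a = 1) ∧ h.input (a + 1) = x
        rw [hM] at h1
        have h2 : (∃ u < h.size, ∃ i < h.opCount u, (u = t ∧ h.input (h.opAddr u i) = 1) ∧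
            h.input (h.opAddr u i + 1) = x) ↔ h.WriteAt t x := by
          constructor
          · rintro ⟨u, -, i, hi, ⟨rfl, h3⟩, h4⟩
            exact ⟨i, hi, h3, h4⟩
          · rintro ⟨i, hi, h3, h4⟩
            exact ⟨t, ht, i, hi, ⟨rfl, h3⟩, h4⟩
        obtain ⟨h3, h4⟩ := hs₂ x _ (h1.trans h2)
        have := i7 x
        by_cases hw : h.WriteAt t x
        · simp [hw, h3 hw]
        · simp only [hw, iff_false, h4 hw]; omega
      refine ⟨?_, ?_, ?_⟩
      · simp [run, e10, e3]; ring
      · intro x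
        have := i7 x
        simp only [run, RamState.setReg_arr, a7]
        obtain ⟨h3, h4⟩ := hs₂ x _ Iff.rfl
        by_cases hw : ∃ k < s.reg 8, (s₁.arr 6 k = t ∧ h.input (s₁.arr 5 k) = 1) ∧
            h.input (s₁.arr 5 k + 1) = x
        · rw [h3 hw]
        · rw [h4 hw]; omega
      · intro x
        simp only [run, RamState.setReg_arr]
        have hx := hs₃ x
        simp only [hW, a5, a6, a8] at hx
        have h1 := b₁.scanned.exists_iff fun a u =>
          (h.input a = 0 ∧ h.WriteAt t (h.input (a + 1))) ∧
            t * (h.size * h.size) + ((h.input (a + 3) - 1) * h.size + u) = x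
        rw [hM] at h1
        have h2 : (∃ u < h.size, ∃ i < h.opCount u,
            (h.input (h.opAddr u i) = 0 ∧ h.WriteAt t (h.input (h.opAddr u i + 1))) ∧
            t * (h.size * h.size) + ((h.input (h.opAddr u i + 3) - 1) * h.size + u) = x) ↔
            ∃ q, x = t * (h.size * h.size) + q ∧ h.ReadAt (h.WriteAt t) q := by
          constructor
          · rintro ⟨u, hu, i, hi, ⟨h3, h4⟩, h5⟩
            exact ⟨_, h5.symm, u, hu, i, hi, h3, h4, rfl⟩
          · rintro ⟨q, h5, u, hu, i, hi, h3, h4, rfl⟩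
            exact ⟨u, hu, i, hi, ⟨h3, h4⟩, h5.symm⟩
        have h3 : (∃ u < t + 1, ∃ q, x = u * (h.size * h.size) + q ∧ h.ReadAt (h.WriteAt u) q) ↔
            (∃ q, x = t * (h.size * h.size) + q ∧ h.ReadAt (h.WriteAt t) q) ∨ s₁.arr 8 x ≠ 0 := by
          rw [i8 x]
          constructor
          · rintro ⟨u, hu, h'⟩
            by_cases hut : u = t
            · subst hut; exact Or.inl h'
            · exact Or.inr ⟨u, by omega, h'⟩
          · rintro (h' | ⟨u, hu, h'⟩)
            · exact ⟨t, by omega, h'⟩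
            · exact ⟨u, by omega, h'⟩
        rw [h3]
        obtain ⟨h4, h5⟩ := hx _ (h1.trans h2)
        by_cases hq : ∃ q, x = t * (h.size * h.size) + q ∧ h.ReadAt (h.WriteAt t) q
        · simp only [hq, h4 hq, true_or, iff_true]; decide
        · simp only [hq, h5 hq, false_or]
    · nlinarith
  · nlinarith

/-- The tables that the search uses. -/
structure Ready (h : History) (s : RamState) : Prop where
  input : s.arr 0 = h.input
  size : s.reg 1 = h.size
  sq : s.reg 3 = h.size * h.size
  two : s.reg 4 = 2 ^ h.size
  pow : ∀ i < h.size, s.arr 2 i = 2 ^ i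
  row : ∀ q < h.size * h.size, s.arr 3 q = q / h.size
  col : ∀ q < h.size * h.size, s.arr 4 q = q % h.size
  reads : ∀ q, s.arr 9 q ≠ 0 ↔ h.ReadAt (fun _ => True) q
  conflicts : ∀ x, s.arr 8 x ≠ 0 ↔
    ∃ u < h.size, ∃ q, x = u * (h.size * h.size) + q ∧ h.ReadAt (h.WriteAt u) q

theorem preprocess_ok (h : History) :
    Ok preprocess (RamState.ofInput h.encode)
      (200 + 200 * (h.size * h.size) +
        600 * (h.size * (1 + ∑ u ∈ Finset.range h.size, h.opCount u))) (Ready h) := by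
  set M := ∑ u ∈ Finset.range h.size, h.opCount u with hMdef
  have hz : ∀ r, (RamState.ofInput h.encode).reg r = 0 := fun _ => rfl
  have hza : ∀ a, a ≠ 0 → ∀ i, (RamState.ofInput h.encode).arr a i = 0 := fun a ha i => by
    simp [RamState.ofInput, ha]
  have h0 : (RamState.ofInput h.encode).arr 0 = h.input := rfl
  have hpos := h.size_pos
  refine ((Ok.set 1 (get 0 (lit 0))).seq fun s₁ F₁ hs₁ => ?_).mono (T := 4 + ((12 + h.size * 40) +
    ((9 + h.size * h.size * 60) + ((20 + (h.size * 40 + M * 50)) +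
      ((9 + M * 60) + (9 + h.size * (60 + M * 300))))))) ?_ fun _ _ h => h
  rotate_left
  · have : h.size ≤ h.size * h.size := Nat.le_mul_of_pos_left _ hpos
    have : M ≤ h.size * M := Nat.le_mul_of_pos_left _ hpos
    nlinarith
  have s1 : s₁.reg 1 = h.size := by rw [hs₁]; simp [h0, h.input_zero]
  refine (tables_ok s1 (F₁.1 3 rfl)).seq fun s₂ F₂ ⟨t3, t4, t1, t2⟩ => ?_
  have s2 : s₂.reg 1 = h.size := (F₂.1 1 rfl).trans s1
  refine (pairs_ok s2 t3 ((F₂.1 5 rfl).trans (F₁.1 5 rfl)) ((F₂.1 6 rfl).trans (F₁.1 6 rfl))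
    hpos).seq fun s₃ F₃ ⟨p3, p4⟩ => ?_
  have i₃ : s₃.arr 0 = h.input := by rw [F₃.2 0 rfl, F₂.2 0 rfl, F₁.2 0 rfl, h0]
  have s3 : s₃.reg 1 = h.size := (F₃.1 1 rfl).trans s2
  have q3 : s₃.reg 3 = h.size * h.size := (F₃.1 3 rfl).trans t3
  have z3 : s₃.reg 8 = 0 := by rw [F₃.1 8 rfl, F₂.1 8 rfl, F₁.1 8 rfl, hz]
  refine ((scan_ok i₃ s3 q3 z3).mono (T' := 20 + (h.size * 40 + M * 50)) ?_
    fun s' _ h => h).seq fun s₄ F₄ hs₄ => ?_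
  · rw [Finset.sum_add_distrib, ← Finset.sum_mul]; simp [hMdef]
  have prep : Prepared h s₄ := by
    refine ⟨(F₄.2 0 rfl).trans i₃, (F₄.1 1 rfl).trans s3, (F₄.1 3 rfl).trans q3, ?_, hs₄⟩
    rw [F₄.2 1 rfl, F₃.2 1 rfl]; exact t1
  have hM : s₄.reg 8 = M := hs₄.1
  refine ((markReads_ok prep ?_).mono (T' := 9 + M * 60) (by rw [hM]) fun s' _ h => h).seq
    fun s₅ F₅ hs₅ => ?_
  · intro x
    rw [F₄.2 9 rfl, F₃.2 9 rfl, F₂.2 9 rfl, F₁.2 9 rfl, hza 9 (by decide)]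
  have prep₅ : Prepared h s₅ := prep.of_eq (F₅.1 1 rfl) (F₅.1 3 rfl) (F₅.1 8 rfl) (F₅.2 0 rfl)
    (F₅.2 1 rfl) (F₅.2 5 rfl) (F₅.2 6 rfl)
  have hM₅ : s₅.reg 8 = M := (F₅.1 8 rfl).trans hM
  refine (markConflicts_ok prep₅ ?_ ?_ ?_).mono (by rw [hM₅]) fun s' F₆ hs₆ => ?_
  · intro x
    rw [F₅.2 7 rfl, F₄.2 7 rfl, F₃.2 7 rfl, F₂.2 7 rfl, F₁.2 7 rfl, hza 7 (by decide)]
  · intro x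
    rw [F₅.2 8 rfl, F₄.2 8 rfl, F₃.2 8 rfl, F₂.2 8 rfl, F₁.2 8 rfl, hza 8 (by decide)]
  · rw [F₅.1 10 rfl, F₄.1 10 rfl, F₃.1 10 rfl, F₂.1 10 rfl, F₁.1 10 rfl, hz]
  · refine ⟨(F₆.2 0 rfl).trans prep₅.input, (F₆.1 1 rfl).trans prep₅.size,
      (F₆.1 3 rfl).trans prep₅.sq, ?_, ?_, ?_, ?_, ?_, hs₆⟩
    · rw [F₆.1 4 rfl, F₅.1 4 rfl, F₄.1 4 rfl, F₃.1 4 rfl, t4]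
    · rw [F₆.2 2 rfl, F₅.2 2 rfl, F₄.2 2 rfl, F₃.2 2 rfl]; exact t2
    · rw [F₆.2 3 rfl, F₅.2 3 rfl, F₄.2 3 rfl]; exact p3
    · rw [F₆.2 4 rfl, F₅.2 4 rfl, F₄.2 4 rfl]; exact p4
    · rw [F₆.2 9 rfl]; exact hs₅

end Checker

/-! ### The search -/

namespace History

variable {h : History}

/-! ### Prefixes as numbers, and the test for continuing them -/

/-- A prefix as a number: the sum of the powers of two with exponents in `P`. -/
def mask {n : ℕ} (P : Finset (Fin n)) : ℕ := ∑ i ∈ P, 2 ^ (i : ℕ)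

theorem mask_eq_sum_map {n : ℕ} (P : Finset (Fin n)) :
    mask P = ∑ k ∈ P.map Fin.valEmbedding, 2 ^ k := by
  rw [Finset.sum_map]; rfl

theorem mask_injective {n : ℕ} : Function.Injective (mask (n := n)) := by
  intro P Q hPQ
  rw [mask_eq_sum_map, mask_eq_sum_map] at hPQ
  exact Finset.map_injective _ (Finset.geomSum_injective le_rfl hPQ)

theorem mask_univ (n : ℕ) : mask (Finset.univ : Finset (Fin n)) = 2 ^ n - 1 := by
  rw [mask, Fin.sum_univ_eq_sum_range (fun i => 2 ^ i), Nat.geomSum_eq le_rfl]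
  simp

theorem mask_insert {n : ℕ} {P : Finset (Fin n)} {t : Fin n} (ht : t ∉ P) :
    mask (insert t P) = mask P + 2 ^ (t : ℕ) := by
  rw [mask, Finset.sum_insert ht, add_comm]; rfl

/-- This makes decoding possible: once the bits above `m` are removed, the rest is at least `2 ^ m`
exactly when `m` is a member. -/
theorem mask_filter_lt {n : ℕ} (P : Finset (Fin n)) (m : ℕ) :
    mask (P.filter fun i => i.val < m) < 2 ^ m := by
  rw [mask_eq_sum_map]
  refine Nat.geomSum_lt le_rfl fun k hk => ?_
  obtain ⟨i, hi, rfl⟩ := Finset.mem_map.1 hk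
  exact (Finset.mem_filter.1 hi).2

theorem mask_filter_succ {n : ℕ} (P : Finset (Fin n)) (i : Fin n) :
    mask (P.filter fun j => j.val < i.val + 1) =
      mask (P.filter fun j => j.val < i.val) + if i ∈ P then 2 ^ (i : ℕ) else 0 := by
  split_ifs with hi
  · rw [← mask_insert (by simp)]
    congr 1
    ext j
    simp only [Finset.mem_filter, Finset.mem_insert, Nat.lt_succ_iff_lt_or_eq, ← Fin.ext_iff]
    constructor
    · rintro ⟨hj, hlt | rfl⟩
      · exact Or.inr ⟨hj, hlt⟩
      · exact Or.inl rfl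
    · rintro (rfl | ⟨hj, hlt⟩)
      · exact ⟨hi, Or.inr rfl⟩
      · exact ⟨hj, Or.inl hlt⟩
  · rw [add_zero]
    congr 1
    refine Finset.filter_congr fun j hj => ?_
    have : j ≠ i := by rintro rfl; exact hi hj
    have := Fin.val_ne_of_ne this
    omega

theorem ReadAt.lt {φ : ℕ → Prop} {q : ℕ} (hq : h.ReadAt φ q) : q < h.size * h.size := by
  obtain ⟨t, ht, i, hi, h0, -, rfl⟩ := hq
  have h1 := src_lt ht hi h0
  have : (h.input (h.opAddr t i + 3) - 1 + 1) * h.size ≤ h.size * h.size :=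
    Nat.mul_le_mul_right _ h1
  nlinarith

/-- The pair with index `q` is a reason why `t` cannot continue `P`. -/
def Blocked (h : History) (P : Finset (Fin h.size)) (t : Fin h.size) (q : ℕ) : Prop :=
  ∃ a c : Fin h.size, q = a * h.size + c ∧
    ((a ∈ P ∧ c ∉ P ∧ c ≠ t ∧ h.Conflict t a c) ∨ (a ∉ P ∧ c = t ∧ h.Pred a t))

/-- One scan over all pairs checks both requirements on `t`: pairs with `c = t` detect a missing
predecessor, pairs with `c ≠ t` a conflict. -/
theorem extends_iff (P : Finset (Fin h.size)) (t : Fin h.size) :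
    h.Extends P t ↔ t ∉ P ∧ ¬ ∃ q < h.size * h.size, h.Blocked P t q := by
  refine and_congr_right fun _ => ?_
  constructor
  · rintro ⟨h1, h2⟩ ⟨q, -, a, c, -, ⟨ha, hc, hct, h3⟩ | ⟨ha, rfl, h3⟩⟩
    · exact h2 a ha c hc hct h3
    · exact ha (h1 a h3)
  · intro hB
    have hlt : ∀ a c : Fin h.size, a.val * h.size + c.val < h.size * h.size := fun a c => by
      have : (a.val + 1) * h.size ≤ h.size * h.size := Nat.mul_le_mul_right _ a.2
      have := c.2
      nlinarith
    refine ⟨fun a ha => ?_, fun a ha c hc hct h3 =>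
      hB ⟨_, hlt a c, a, c, rfl, Or.inl ⟨ha, hc, hct, h3⟩⟩⟩
    by_contra haP
    exact hB ⟨_, hlt a t, a, t, rfl, Or.inr ⟨haP, rfl, ha⟩⟩

end History

namespace Checker

open Stm Ex History

variable {h : History} {s : RamState}

/-- The test whether the current pair prevents the current transaction from continuing the current
prefix. -/
def blocked : Ex :=
  .or
    (.and (.and (get 12 (get 3 (var 16))) (.not (get 12 (get 4 (var 16)))))
      (.and (.not (.eq (get 4 (var 16)) (var 9))) (get 8 (.add (var 10) (var 16)))))
    (.and (.and (.not (get 12 (get 3 (var 16)))) (.eq (get 4 (var 16)) (var 9)))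
      (.or (get 0 (.add (lit 1) (var 16))) (get 9 (var 16))))

/-- The code of the current prefix with the current transaction added. -/
def next : Ex := .add (var 14) (get 2 (var 9))

/-- Try to continue the current prefix by the current transaction. -/
def step : Stm :=
  put 13 (lit 0) (lit 0) ;;
  mark 16 3 13 blocked (lit 0) (lit 1) ;;
  .ite (.not (.or (get 13 (lit 0)) (.or (get 12 (var 9)) (get 10 next))))
    (put 10 next (lit 1) ;; put 11 (var 13) next ;; .set 13 (.add (var 13) (lit 1)))
    (.set 0 (lit 0)) ;;
  .set 10 (.add (var 10) (var 3))

/-- The number `n - 1 - i`. -/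
def top : Ex := .sub (.sub (var 1) (lit 1)) (var 2)

/-- Compute the members of the current prefix from its code. -/
def decode : Stm :=
  upTo 2 1 (.ite (.sub (.add (var 15) (lit 1)) (get 2 top))
    (put 12 top (lit 1) ;; .set 15 (.sub (var 15) (get 2 top)))
    (put 12 top (lit 0)))

/-- Take a prefix from the queue and try all ways to continue it. -/
def visit : Stm :=
  .set 14 (get 11 (var 12)) ;; .set 12 (.add (var 12) (lit 1)) ;; .set 15 (var 14) ;;
  decode ;; .set 10 (lit 0) ;; upTo 9 1 step

/-- Find all prefixes. -/
def search : Stm :=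
  put 10 (lit 0) (lit 1) ;; put 11 (lit 0) (lit 0) ;; .set 13 (lit 1) ;;
  .loop (.sub (var 13) (var 12)) visit

/-- The program that checks serializability. -/
def check : Stm :=
  preprocess ;; search ;;
  .set 0 (.sub (lit 1) (.sub (lit 1) (get 10 (.sub (var 4) (lit 1)))))

theorem Ready.of_eq {s' : RamState} (hs : Ready h s) (h1 : s'.reg 1 = s.reg 1)
    (h3 : s'.reg 3 = s.reg 3) (h4 : s'.reg 4 = s.reg 4) (a0 : s'.arr 0 = s.arr 0)
    (a2 : s'.arr 2 = s.arr 2) (a3 : s'.arr 3 = s.arr 3) (a4 : s'.arr 4 = s.arr 4)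
    (a8 : s'.arr 8 = s.arr 8) (a9 : s'.arr 9 = s.arr 9) : Ready h s' := by
  obtain ⟨i1, i2, i3, i4, i5, i6, i7, i8, i9⟩ := hs
  exact ⟨by rw [a0, i1], by rw [h1, i2], by rw [h3, i3], by rw [h4, i4], by rw [a2]; exact i5,
    by rw [a3]; exact i6, by rw [a4]; exact i7, by rw [a9]; exact i8, by rw [a8]; exact i9⟩

/-- The array `12` holds the members of `P`. -/
def Members (P : Finset (Fin h.size)) (s : RamState) : Prop :=
  ∀ i : Fin h.size, s.arr 12 i = if i ∈ P then 1 else 0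

theorem blocked_val (hs : Ready h s) {P : Finset (Fin h.size)} (hP : Members P s) {t : Fin h.size}
    (h9 : s.reg 9 = t) (h10 : s.reg 10 = t * (h.size * h.size)) {q : ℕ}
    (hq : q < h.size * h.size) (h16 : s.reg 16 = q) :
    blocked.val s = 0 ↔ ¬ h.Blocked P t q := by
  have hpos := h.size_pos
  obtain ⟨a, ha⟩ : ∃ a : Fin h.size, a.val = q / h.size :=
    ⟨⟨q / h.size, Nat.div_lt_of_lt_mul hq⟩, rfl⟩
  obtain ⟨c, hc⟩ : ∃ c : Fin h.size, c.val = q % h.size :=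
    ⟨⟨q % h.size, Nat.mod_lt _ hpos⟩, rfl⟩
  have hqac : q = a * h.size + c := by
    rw [ha, hc, mul_comm]; exact (Nat.div_add_mod q h.size).symm
  -- The address splits uniquely into `t` and `q`, since indices of pairs are below `size * size`.
  have hconf : s.arr 8 (t * (h.size * h.size) + q) ≠ 0 ↔ h.Conflict t a c := by
    rw [hs.conflicts]
    have : h.Conflict t a c ↔ h.ReadAt (h.WriteAt t) q := by
      rw [hqac, readAt_iff]
      simp only [Conflict, writeAt_iff, and_comm]
    rw [this]
    constructor
    · rintro ⟨u, -, q', hqq, hR⟩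
      have hq' := hR.lt
      have hut : t.val = u := by
        have := congrArg (· / (h.size * h.size)) hqq
        simpa [Nat.mul_add_div, Nat.add_div_of_dvd_right, Nat.div_eq_of_lt, hq, hq', hpos.ne',
          Nat.mul_div_cancel, hpos] using this
      subst hut
      obtain rfl : q = q' := by omega
      exact hR
    · exact fun hR => ⟨t, t.2, q, rfl, hR⟩
  have hpred : (s.arr 0 (1 + q) ≠ 0 ∨ s.arr 9 q ≠ 0) ↔ h.Pred a c := by
    rw [hs.reads, hs.input, hqac, input_so, readAt_iff]
    refine or_congr ?_ ?_
    · cases h.so a c <;> simp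
    · simp [RawHistory.wr]
  have hB : h.Blocked P t q ↔
      (a ∈ P ∧ c ∉ P ∧ c ≠ t ∧ h.Conflict t a c) ∨ (a ∉ P ∧ c = t ∧ h.Pred a t) := by
    constructor
    · rintro ⟨a', c', hq', h'⟩
      have e1 : c' = c := by
        refine Fin.ext ?_
        rw [hc, hq', Nat.mul_comm, Nat.mul_add_mod, Nat.mod_eq_of_lt c'.2]
      have e2 : a' = a := by
        refine Fin.ext ?_
        subst e1
        exact Nat.eq_of_mul_eq_mul_right hpos (by omega)
      subst e1 e2
      exact h'
    · exact fun h' => ⟨a, c, hqac, h'⟩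
  have hct : c.val = t.val ↔ c = t := Fin.ext_iff.symm
  have hPa : s.arr 12 a = 0 ↔ a ∉ P := by rw [hP a]; simp
  have hPc : s.arr 12 c = 0 ↔ c ∉ P := by rw [hP c]; simp
  have hpred' : (s.arr 0 (1 + q) = 0 ∧ s.arr 9 q = 0) ↔ ¬ h.Pred a c := by
    rw [← hpred, not_or, not_not, not_not]
  have hconf' : s.arr 8 (t * (h.size * h.size) + q) = 0 ↔ ¬ h.Conflict t a c := by
    rw [← hconf, not_not]
  have hval : blocked.val s = 0 ↔
      ((a ∉ P ∨ c ∈ P) ∨ c = t ∨ ¬ h.Conflict t a c) ∧ ((a ∈ P ∨ c ≠ t) ∨ ¬ h.Pred a c) := by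
    simp only [blocked, Ex.val, Ex.val_and_eq_zero, Ex.val_or_eq_zero, Ex.val_not_eq_zero,
      Ex.val_eq_eq_zero, h16, h9, h10, hs.row q hq, hs.col q hq, ← ha, ← hc, hPa, hPc, hct,
      hpred', hconf', ne_eq, not_not]
  rw [hval, hB]
  clear * -
  by_cases hct : c = t
  · subst hct
    simp only [ne_eq, not_true_eq_false, true_or, or_true, or_false, false_and, and_false,
      true_and, false_or, not_and]
    tauto
  · simp only [hct, ne_eq, not_false_eq_true, false_or, or_true, true_or, false_and, and_false,
      true_and, or_false, and_true, not_and]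
    tauto

theorem decode_ok (hs : Ready h s) (P : Finset (Fin h.size)) (h15 : s.reg 15 = mask P) :
    Ok decode s (9 + h.size * 100) (Members P) := by
  refine (Ok.upTo_const (n := h.size)
    -- Bits are peeled off from the top: after `k` rounds only those below `size - k` remain in the
    -- code.
    (fun k s => s.reg 15 = mask (P.filter fun i => i.val < h.size - k) ∧
      ∀ i : Fin h.size, h.size - k ≤ i → s.arr 12 i = if i ∈ P then 1 else 0)
    88 hs.size rfl rfl (by decide) ?_ ?_).mono le_rfl fun s' _ h => fun i => h.2.2 i (by simp)
  · refine ⟨?_, fun i hi => by have := i.2; omega⟩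
    simp [h15]
  · rintro k hk s₁ h2 hF ⟨i15, i12⟩
    have e1 : s₁.reg 1 = h.size := (hF.1 1 rfl).trans hs.size
    obtain ⟨m, hm⟩ : ∃ m : Fin h.size, m.val = h.size - 1 - k := ⟨⟨_, by omega⟩, rfl⟩
    have hmk : h.size - k = m.val + 1 := by omega
    have hmk' : h.size - (k + 1) = m.val := by omega
    have htop : top.val s₁ = m := by simp [top, e1, h2, hm]
    have hpow : s₁.arr 2 m = 2 ^ m.val := by rw [hF.2 2 rfl]; exact hs.pow _ m.2
    rw [hmk, mask_filter_succ] at i15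
    have hlt := mask_filter_lt P m.val
    refine Ok.of_flat rfl (by decide) fun _ => ?_
    have hcell : ∀ (i : Fin h.size) (x : ℕ), m.val ≤ i → x = (if m ∈ P then 1 else 0) →
        (if i.val = m.val then x else s₁.arr 12 i) = if i ∈ P then 1 else 0 := by
      intro i x hi hx
      by_cases him : i = m
      · subst him; simp [hx]
      · have := Fin.val_ne_of_ne him
        rw [if_neg this]
        exact i12 i (by omega)
    rw [hmk']
    by_cases hmP : m ∈ P
    · rw [if_pos hmP] at i15
      have hc : mask (P.filter fun i => i.val < m.val) + 2 ^ m.val + 1 - 2 ^ m.val ≠ 0 := by omega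
      have htop' : top.val (s₁.setArr 12 m 1) = m := htop
      simp only [run, Ex.val, htop, htop', hpow, i15, hc, if_true, ne_eq, not_false_eq_true,
        RamState.setReg_reg, RamState.setReg_arr, RamState.setArr_reg, RamState.setArr_arr_apply]
      refine ⟨by simp, fun i hi => ?_⟩
      simpa using hcell i 1 hi (by simp [hmP])
    · rw [if_neg hmP, add_zero] at i15
      have hc : mask (P.filter fun i => i.val < m.val) + 1 - 2 ^ m.val = 0 := by omega
      simp only [run, Ex.val, htop, hpow, i15, hc, if_false, ne_eq, not_true_eq_false,
        RamState.setReg_reg, RamState.setReg_arr, RamState.setArr_reg, RamState.setArr_arr_apply]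
      refine ⟨by simp, fun i hi => ?_⟩
      simpa using hcell i 0 hi (by simp [hmP])

/-! ### The invariant of the search -/

/-- The prefixes found so far are those in the list `L`, and all ways to continue the first `d` of
them have been tried. -/
structure Found (h : History) (L : List (Finset (Fin h.size))) (d : ℕ) (s : RamState) : Prop where
  ready : Ready h s
  tail : s.reg 13 = L.length
  queue : ∀ j P, L[j]? = some P → s.arr 11 j = mask P
  seen : ∀ P, s.arr 10 (mask P) ≠ 0 ↔ P ∈ L
  nodup : L.Nodup
  reach : ∀ P ∈ L, h.Reach P
  empty : ∅ ∈ L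
  closed : ∀ j < d, ∀ P, L[j]? = some P → ∀ t, h.Extends P t → insert t P ∈ L

theorem Found.of_eq {L : List (Finset (Fin h.size))} {d : ℕ} {s' : RamState} (hs : Found h L d s)
    (hr : Ready h s') (h13 : s'.reg 13 = s.reg 13) (a10 : s'.arr 10 = s.arr 10)
    (a11 : s'.arr 11 = s.arr 11) : Found h L d s' := by
  obtain ⟨-, i2, i3, i4, i5, i6, i7, i8⟩ := hs
  exact ⟨hr, by rw [h13, i2], by rw [a11]; exact i3, by rw [a10]; exact i4, i5, i6, i7, i8⟩

theorem Found.length_le {L : List (Finset (Fin h.size))} {d : ℕ} (hs : Found h L d s) :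
    L.length ≤ 1 + h.size ^ h.width := by
  classical
  rw [← List.toFinset_card_of_nodup hs.nodup]
  exact h.card_prefixes_le _ fun P hP => hs.reach P (List.mem_toFinset.1 hP)

/-- When every listed prefix has been processed, the list contains `∅` and is closed under
continuation, so it contains all reachable prefixes. -/
theorem Found.mem_iff {L : List (Finset (Fin h.size))} (hs : Found h L L.length s)
    (P : Finset (Fin h.size)) : P ∈ L ↔ h.Reach P := by
  refine ⟨hs.reach P, fun hP => ?_⟩
  induction hP with
  | empty => exact hs.empty
  | step _ ht ih =>
    obtain ⟨j, hj⟩ := List.mem_iff_getElem?.1 ih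
    exact hs.closed j (List.getElem?_eq_some_iff.1 hj).1 _ hj _ ht

theorem Found.push {L : List (Finset (Fin h.size))} {d : ℕ} (hs : Found h L d s)
    {P : Finset (Fin h.size)} {t : Fin h.size} (hP : P ∈ L) (ht : h.Extends P t)
    (hnew : insert t P ∉ L) (hd : d ≤ L.length) :
    Found h (L ++ [insert t P]) d
      (((s.setArr 10 (mask (insert t P)) 1).setArr 11 L.length (mask (insert t P))).setReg 13
        (L.length + 1)) := by
  refine ⟨hs.ready.of_eq rfl rfl rfl rfl rfl rfl rfl rfl rfl, by simp, ?_, ?_, ?_, ?_, ?_, ?_⟩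
  · intro j Q hj
    simp only [RamState.setReg_arr, RamState.setArr_arr_apply, true_and]
    by_cases hjL : j = L.length
    · subst hjL
      simp at hj
      simp [hj]
    · have hlt := (List.getElem?_eq_some_iff.1 hj).1
      simp only [List.length_append, List.length_singleton] at hlt
      rw [List.getElem?_append_left (by omega)] at hj
      simpa [hjL] using hs.queue j Q hj
  · intro Q
    simp only [RamState.setReg_arr, RamState.setArr_arr_apply, true_and, mask_injective.eq_iff]
    by_cases hQ : Q = insert t P
    · simp [hQ]
    · simpa [hQ] using hs.seen Q
  · exact List.nodup_append.2 ⟨hs.nodup, List.nodup_singleton _, by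
      rintro a ha b hb rfl
      exact hnew (List.mem_singleton.1 hb ▸ ha)⟩
  · intro Q hQ
    rcases List.mem_append.1 hQ with hQ | hQ
    · exact hs.reach Q hQ
    · rw [List.mem_singleton.1 hQ]; exact (hs.reach P hP).step ht
  · exact List.mem_append_left _ hs.empty
  · intro j hj Q hQ u hu
    rw [List.getElem?_append_left (by omega)] at hQ
    exact List.mem_append_left _ (hs.closed j hj Q hQ u hu)

/-- The list changes only at its end, so position `d` still holds `P` afterwards. A continuation
found before is already listed and is not queued again, which keeps the list free of duplicates. -/
theorem step_ok {L : List (Finset (Fin h.size))} {d : ℕ} (hs : Found h L d s)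
    {P : Finset (Fin h.size)} {t : Fin h.size} (hP : L[d]? = some P) (hM : Members P s)
    (h9 : s.reg 9 = t) (h10 : s.reg 10 = t * (h.size * h.size)) (h14 : s.reg 14 = mask P) :
    Ok step s (100 + h.size * h.size * 200) (fun s' => ∃ L', Found h L' d s' ∧
      L'[d]? = some P ∧ L ⊆ L' ∧ (h.Extends P t → insert t P ∈ L') ∧
      s'.reg 10 = (t + 1) * (h.size * h.size)) := by
  have hdL := (List.getElem?_eq_some_iff.1 hP).1
  refine ((Ok.put 13 (lit 0) (lit 0)).seq fun s₁ F₁ hs₁ => (Ok.mark (V := 1)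
    (n := h.size * h.size) (T := 188) (fun q => h.Blocked P t q) (fun _ => 0) ?_ (by decide)
    (by decide) (by decide) (by decide) ?_).seq fun s₂ F₂ hs₂ =>
    Ok.of_flat (T := 85) rfl (by decide) ?_).mono ?_ fun _ _ h => h
  · exact (F₁.1 3 rfl).trans hs.ready.sq
  · intro q hq s' h16 hr ha
    have hready : Ready h s' := hs.ready.of_eq
      ((hr 1 (by decide) (by decide)).trans (F₁.1 1 rfl))
      ((hr 3 (by decide) (by decide)).trans (F₁.1 3 rfl))
      ((hr 4 (by decide) (by decide)).trans (F₁.1 4 rfl))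
      ((ha 0 (by decide)).trans (F₁.2 0 rfl)) ((ha 2 (by decide)).trans (F₁.2 2 rfl))
      ((ha 3 (by decide)).trans (F₁.2 3 rfl)) ((ha 4 (by decide)).trans (F₁.2 4 rfl))
      ((ha 8 (by decide)).trans (F₁.2 8 rfl)) ((ha 9 (by decide)).trans (F₁.2 9 rfl))
    refine ⟨blocked_val hready (P := P) ?_ ?_ ?_ hq h16, fun _ => rfl, rfl⟩
    · intro i
      rw [ha 12 (by decide), F₁.2 12 rfl]; exact hM i
    · rw [hr 9 (by decide) (by decide), F₁.1 9 rfl, h9]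
    · rw [hr 10 (by decide) (by decide), F₁.1 10 rfl, h10]
  · intro _
    have a13 : s₁.arr 13 0 = 0 := by rw [hs₁]; simp
    obtain ⟨g1, g2⟩ := hs₂ 0 (∃ q < h.size * h.size, h.Blocked P t q) (by simp)
    have hready : Ready h s₂ := hs.ready.of_eq
      ((F₂.1 1 rfl).trans (F₁.1 1 rfl)) ((F₂.1 3 rfl).trans (F₁.1 3 rfl))
      ((F₂.1 4 rfl).trans (F₁.1 4 rfl)) ((F₂.2 0 rfl).trans (F₁.2 0 rfl))
      ((F₂.2 2 rfl).trans (F₁.2 2 rfl)) ((F₂.2 3 rfl).trans (F₁.2 3 rfl))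
      ((F₂.2 4 rfl).trans (F₁.2 4 rfl)) ((F₂.2 8 rfl).trans (F₁.2 8 rfl))
      ((F₂.2 9 rfl).trans (F₁.2 9 rfl))
    have e9 : s₂.reg 9 = t := by rw [F₂.1 9 rfl, F₁.1 9 rfl, h9]
    have e10 : s₂.reg 10 = t * (h.size * h.size) := by rw [F₂.1 10 rfl, F₁.1 10 rfl, h10]
    have e13 : s₂.reg 13 = L.length := by rw [F₂.1 13 rfl, F₁.1 13 rfl, hs.tail]
    have e14 : s₂.reg 14 = mask P := by rw [F₂.1 14 rfl, F₁.1 14 rfl, h14]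
    have a10 : s₂.arr 10 = s.arr 10 := (F₂.2 10 rfl).trans (F₁.2 10 rfl)
    have a11 : s₂.arr 11 = s.arr 11 := (F₂.2 11 rfl).trans (F₁.2 11 rfl)
    have a12 : s₂.arr 12 t = 0 ↔ t ∉ P := by
      rw [F₂.2 12 rfl, F₁.2 12 rfl, hM t]; simp
    have hF₂ : Found h L d s₂ := hs.of_eq hready ((F₂.1 13 rfl).trans (F₁.1 13 rfl)) a10 a11
    have hnext : next.val s₂ = mask P + 2 ^ t.val := by
      simp only [next, Ex.val, e14, e9, hready.pow _ t.2]
    have hflag : s₂.arr 13 0 = 0 ↔ ¬ ∃ q < h.size * h.size, h.Blocked P t q := by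
      constructor
      · intro h0 hB
        rw [g1 hB] at h0; omega
      · intro hB
        rw [g2 hB, a13]
    have hext := extends_iff P t
    set G : Ex := .not (.or (get 13 (lit 0)) (.or (get 12 (var 9)) (get 10 next))) with hG
    have hguard : G.val s₂ ≠ 0 ↔ h.Extends P t ∧ insert t P ∉ L := by
      rw [hG, ne_eq, Ex.val_not_eq_zero, not_not, Ex.val_or_eq_zero, Ex.val_or_eq_zero]
      simp only [Ex.val, hflag, e9, a12, hnext, hext]
      by_cases htP : t ∈ P
      · simp [htP]
      · rw [← mask_insert htP]
        have := hF₂.seen (insert t P)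
        tauto
    by_cases hg : G.val s₂ ≠ 0
    · obtain ⟨hE, hnew⟩ := hguard.1 hg
      rw [← mask_insert hE.1] at hnext
      have hpush := hF₂.push (List.mem_of_getElem? hP) hE hnew hdL.le
      have hnext' : next.val (s₂.setArr 10 (mask (insert t P)) 1) = mask (insert t P) := by
        rw [← hnext]; rfl
      refine ⟨L ++ [insert t P], ?_, ?_, List.subset_append_left _ _, fun _ => by simp, ?_⟩
      · simp only [run, if_pos hg, hnext, Ex.val, RamState.setArr_reg, e13, hnext']
        exact hpush.of_eq (hpush.ready.of_eq rfl rfl rfl rfl rfl rfl rfl rfl rfl) rfl rfl rfl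
      · rwa [List.getElem?_append_left hdL]
      · simp [run, hg, e10, hready.sq]; ring
    · have hE := mt hguard.2 hg
      refine ⟨L, ?_, hP, List.Subset.refl _, fun h' => by tauto, ?_⟩
      · simp only [run, hg, if_false]
        exact hF₂.of_eq (hready.of_eq rfl rfl rfl rfl rfl rfl rfl rfl rfl) rfl rfl rfl
      · simp only [run, hg, if_false]
        simp [e10, hready.sq]; ring
  · simp only [Ex.cost]; omega

end Checker

namespace Checker

open Stm Ex History

variable {h : History} {s : RamState}

theorem visit_ok {L : List (Finset (Fin h.size))} {d : ℕ} (hs : Found h L d s)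
    (h12 : s.reg 12 = d) (hd : d < L.length) :
    Ok visit s (100 + h.size * 300 + h.size * (h.size * h.size) * 200) (fun s' =>
      s'.reg 12 = d + 1 ∧ ∃ L', Found h L' (d + 1) s' ∧ d + 1 ≤ L'.length) := by
  obtain ⟨P, hP⟩ : ∃ P, L[d]? = some P := ⟨_, List.getElem?_eq_getElem hd⟩
  refine ((Ok.set 14 (get 11 (var 12))).seq fun s₁ F₁ hs₁ =>
    (Ok.set 12 (.add (var 12) (lit 1))).seq fun s₂ F₂ hs₂ =>
    (Ok.set 15 (var 14)).seq fun s₃ F₃ hs₃ => ?_).mono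
    (T := 5 + (6 + (4 + ((9 + h.size * 100) +
      (3 + (9 + h.size * ((100 + h.size * h.size * 200) + 12))))))) ?_ fun _ _ h => h
  rotate_left
  · nlinarith
  have e14 : s₃.reg 14 = mask P := by
    rw [F₃.1 14 rfl, F₂.1 14 rfl, hs₁]
    simp [h12, hs.queue d P hP]
  have e12 : s₃.reg 12 = d + 1 := by
    rw [F₃.1 12 rfl, hs₂]
    simp [F₁.1 12 rfl, h12]
  have e15 : s₃.reg 15 = mask P := by
    rw [← e14, F₃.1 14 rfl, hs₃]; simp
  have hr₃ : Ready h s₃ := by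
    subst hs₁ hs₂ hs₃
    exact hs.ready.of_eq rfl rfl rfl rfl rfl rfl rfl rfl rfl
  have hs3 : Found h L d s₃ := by
    subst hs₁ hs₂ hs₃
    exact hs.of_eq hr₃ rfl rfl rfl
  refine (decode_ok hr₃ P e15).seq fun s₄ F₄ hM => (Ok.set 10 (lit 0)).seq fun s₅ F₅ hs₅ => ?_
  have hr₅ : Ready h s₅ := hr₃.of_eq
    ((F₅.1 1 rfl).trans (F₄.1 1 rfl)) ((F₅.1 3 rfl).trans (F₄.1 3 rfl))
    ((F₅.1 4 rfl).trans (F₄.1 4 rfl)) ((F₅.2 0 rfl).trans (F₄.2 0 rfl))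
    ((F₅.2 2 rfl).trans (F₄.2 2 rfl)) ((F₅.2 3 rfl).trans (F₄.2 3 rfl))
    ((F₅.2 4 rfl).trans (F₄.2 4 rfl)) ((F₅.2 8 rfl).trans (F₄.2 8 rfl))
    ((F₅.2 9 rfl).trans (F₄.2 9 rfl))
  have hs5 : Found h L d s₅ := hs3.of_eq hr₅ ((F₅.1 13 rfl).trans (F₄.1 13 rfl))
    ((F₅.2 10 rfl).trans (F₄.2 10 rfl)) ((F₅.2 11 rfl).trans (F₄.2 11 rfl))
  have e10 : s₅.reg 10 = 0 := by rw [hs₅]; simp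
  refine (Ok.upTo_const (n := h.size) (fun k s => s.reg 10 = k * (h.size * h.size) ∧
    ∃ L', Found h L' d s ∧ L'[d]? = some P ∧
      ∀ t : Fin h.size, t.val < k → h.Extends P t → insert t P ∈ L')
    (100 + h.size * h.size * 200) hr₅.size rfl rfl (by decide) ?_ ?_).mono le_rfl ?_
  · refine ⟨by simpa using e10, L, hs5.of_eq ?_ rfl rfl rfl, hP, by simp⟩
    exact hr₅.of_eq rfl rfl rfl rfl rfl rfl rfl rfl rfl
  · rintro k hk s₆ h9 F₆ ⟨i10, L', hs6, hP', hclosed⟩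
    refine (step_ok hs6 (t := ⟨k, hk⟩) hP' ?_ h9 i10 ?_).mono le_rfl ?_
    · intro i
      rw [F₆.2 12 rfl, F₅.2 12 rfl]; exact hM i
    · rw [F₆.1 14 rfl, F₅.1 14 rfl, F₄.1 14 rfl, e14]
    · rintro s₇ - ⟨L'', hs7, hP'', hsub, hnew, i10'⟩
      refine ⟨by simpa using i10', L'', hs7.of_eq ?_ rfl rfl rfl, hP'', fun t ht hE => ?_⟩
      · exact hs7.ready.of_eq rfl rfl rfl rfl rfl rfl rfl rfl rfl
      · by_cases htk : t.val = k
        · obtain rfl : t = ⟨k, hk⟩ := Fin.ext htk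
          exact hnew hE
        · exact hsub (hclosed t (by omega) hE)
  · rintro s₆ F₆ ⟨-, -, L', hs6, hP', hclosed⟩
    refine ⟨by rw [F₆.1 12 rfl, F₅.1 12 rfl, F₄.1 12 rfl, e12], L', ?_,
      (List.getElem?_eq_some_iff.1 hP').1⟩
    obtain ⟨i1, i2, i3, i4, i5, i6, i7, i8⟩ := hs6
    refine ⟨i1, i2, i3, i4, i5, i6, i7, fun j hj Q hQ t ht => ?_⟩
    by_cases hjd : j = d
    · subst hjd
      obtain rfl : P = Q := by rw [hP'] at hQ; exact Option.some.inj hQ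
      exact hclosed t t.2 ht
    · exact i8 j (by omega) Q hQ t ht

theorem search_ok (hs : Ready h s) (h10 : ∀ x, s.arr 10 x = 0) (h12 : s.reg 12 = 0) :
    Ok search s (20 + (1 + h.size ^ h.width) *
      (110 + h.size * 300 + h.size * (h.size * h.size) * 200))
      (fun s' => Ready h s' ∧ (s'.arr 10 (2 ^ h.size - 1) ≠ 0 ↔ h.Serializable)) := by
  set K := 110 + h.size * 300 + h.size * (h.size * h.size) * 200 with hK
  refine ((Ok.put 10 (lit 0) (lit 1)).seq fun s₁ F₁ hs₁ =>
    (Ok.put 11 (lit 0) (lit 0)).seq fun s₂ F₂ hs₂ =>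
    (Ok.set 13 (lit 1)).seq fun s₃ F₃ hs₃ =>
    (Ok.loop (fun s => ∃ L, Found h L (s.reg 12) s ∧ s.reg 12 ≤ L.length)
      -- The head never passes the tail, and the tail is bounded by the number of reachable
      -- prefixes. Each visit moves the head by one and so releases `K`, which covers the visit and
      -- the next test.
      (fun s => (1 + h.size ^ h.width - s.reg 12) * K) ?_ ?_).mono
      (T' := 6 + (1 + h.size ^ h.width) * K) ?_ fun _ _ h => h).mono ?_ ?_
  · subst hs₁ hs₂ hs₃
    refine ⟨[∅], ?_, by simp [h12]⟩
    refine ⟨hs.of_eq rfl rfl rfl rfl rfl rfl rfl rfl rfl, by simp, ?_, ?_, by simp, ?_, by simp, ?_⟩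
    · intro j P hj
      have hj0 : j = 0 := by
        have := (List.getElem?_eq_some_iff.1 hj).1
        simpa using this
      subst hj0
      obtain rfl : ∅ = P := by simpa using hj
      simp [mask]
    · intro P
      have : mask P = 0 ↔ P = ∅ := by
        rw [← mask_injective.eq_iff]; simp [mask]
      simp [h10, this]
    · intro P hP
      rw [List.mem_singleton.1 hP]; exact Reach.empty
    · intro j hj
      simp [h12] at hj
  · rintro s₄ ⟨L, hL, hle⟩ hne
    simp only [Ex.val, hL.tail] at hne
    refine ⟨100 + h.size * 300 + h.size * (h.size * h.size) * 200,
      (visit_ok hL rfl (by omega)).mono le_rfl ?_⟩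
    rintro s₅ - ⟨h12', L', hL', hle'⟩
    rw [← h12'] at hL' hle'
    refine ⟨⟨L', hL', hle'⟩, ?_⟩
    have := hL.length_le
    obtain ⟨m, hm⟩ : ∃ m, 1 + h.size ^ h.width - s₄.reg 12 = m + 1 :=
      ⟨1 + h.size ^ h.width - s₄.reg 12 - 1, by omega⟩
    have hm' : 1 + h.size ^ h.width - s₅.reg 12 = m := by omega
    rw [hm, hm', add_mul, one_mul]
    simp only [Ex.cost, hK]; omega
  · subst hs₁ hs₂ hs₃
    simp [h12]
  · simp only [Ex.cost]; omega
  · rintro s₄ - ⟨⟨L, hL, hle⟩, hv⟩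
    simp only [Ex.val, hL.tail] at hv
    refine ⟨hL.ready, ?_⟩
    have hd : s₄.reg 12 = L.length := by omega
    rw [hd] at hL
    -- At exit head and tail agree, so the list is complete; the cell `2 ^ size - 1` belongs to the
    -- set of all transactions.
    rw [serializable_iff_reach, ← hL.mem_iff, ← mask_univ]
    exact hL.seen _

/-! ### The final bounds -/

/-- The bound on the running time. -/
noncomputable def steps (h : History) : ℕ :=
  h.size ^ h.width * h.size ^ 3 + h.size * h.encode.length

open Classical in
theorem check_ok (h : History) :
    Ok check (RamState.ofInput h.encode) (3000 * steps h)
      (fun s => s.reg 0 = if h.Serializable then 1 else 0) := by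
  refine ((preprocess_ok h).seq fun s₁ F₁ hs₁ => (search_ok hs₁ ?_ ?_).seq fun s₂ F₂ hs₂ =>
    Ok.of_flat (T := 20) rfl (by decide) ?_).mono ?_ fun _ _ h => h
  · intro x
    rw [F₁.2 10 rfl]; rfl
  · rw [F₁.1 12 rfl]; rfl
  · intro _
    obtain ⟨hr, hser⟩ := hs₂
    -- The double truncated subtraction turns any nonzero mark into 1.
    simp only [run, Ex.val, hr.two, RamState.setReg_reg, if_true]
    by_cases hS : h.Serializable
    · have := hser.2 hS
      rw [if_pos hS]; omega
    · have := mt hser.1 hS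
      rw [if_neg hS]; omega
  · have hpos := h.size_pos
    have hpow : 0 < h.size ^ h.width := Nat.pow_pos hpos
    have hlen := h.length_encode
    have hM : h.size + ∑ u ∈ Finset.range h.size, h.opCount u ≤ h.encode.length := by
      rw [hlen, Finset.sum_add_distrib, ← Finset.mul_sum]
      simp; omega
    have hn2 : h.size * h.size ≤ h.encode.length := by rw [hlen]; omega
    simp only [steps]
    generalize h.size ^ h.width = W at *
    generalize ∑ u ∈ Finset.range h.size, h.opCount u = M at *
    generalize h.encode.length = N at *
    generalize h.size = n at *
    have h1 : n * (1 + M) ≤ n * N := Nat.mul_le_mul_left _ (by omega)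
    have h2 : n * n ≤ n * N := Nat.mul_le_mul_left _ (by omega)
    -- Here `1 + W ≤ 2 * W`, and `610 = 110 + 300 + 200` after bounding `1` and `n` by `n ^ 3`.
    have h3 : (1 + W) * (110 + n * 300 + n * (n * n) * 200) ≤ 2 * W * (610 * n ^ 3) := by
      refine Nat.mul_le_mul (by omega) ?_
      have : n ≤ n ^ 3 := Nat.le_self_pow (by decide) n
      have : n * (n * n) = n ^ 3 := by ring
      omega
    have h4 : 2 * W * (610 * n ^ 3) = 1220 * (W * n ^ 3) := by ring
    have h5 : 1 ≤ n * N := Nat.mul_pos hpos (by omega)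
    omega

/-- The machine program that checks serializability. -/
def program : Prog := check.prog

theorem exists_checksSer (h : History) :
    ∃ t b, ChecksSer program h t b ∧ t ≤ 3000 * steps h := by
  obtain ⟨t, b, σ, s, hE, ht, hS, -, hs⟩ := check_ok h (RamState.ofInput h.encode)
    -- The initial memory represents itself, as all registers are zero.
    ⟨fun _ => rfl, rfl⟩
  exact ⟨t, b, ⟨σ, hE, (hS.1 0).trans hs⟩, ht⟩

theorem steps_le {h : History} {k : ℕ} (hk : h.width ≤ k) :
    steps h ≤ bitLength h.encode ^ (k + 3) + bitLength h.encode ^ 2 := by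
  have hN := length_le_bitLength h.encode
  have hn : h.size ≤ bitLength h.encode := by
    have := h.length_encode
    have := Nat.le_mul_of_pos_left h.size h.size_pos
    omega
  have h1 : h.size ^ h.width * h.size ^ 3 ≤ bitLength h.encode ^ (k + 3) := by
    rw [← pow_add]
    exact (Nat.pow_le_pow_right h.size_pos (by omega)).trans (Nat.pow_le_pow_left hn _)
  have h2 := Nat.mul_le_mul hn hN
  rw [← pow_two] at h2
  exact Nat.add_le_add h1 h2

end Checker

open Checker in
theorem mainTheorem6 :
    ∃ p : Prog,
      (∃ C : ℕ, ∀ h : History, ∃ t b : ℕ, ChecksSer p h t b ∧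
        t ≤ C * (h.size ^ h.width * h.size ^ 3 + h.size * h.encode.length)) ∧
      ∀ k : ℕ, ∃ P : Polynomial ℕ, ∀ h : History, h.width ≤ k →
        ∃ t b : ℕ, ChecksSer p h t b ∧ b ≤ P.eval (bitLength h.encode) := by
  refine ⟨program, ⟨3000, exists_checksSer⟩, fun k => ?_⟩
  let T : Polynomial ℕ := 3000 * (Polynomial.X ^ (k + 3) + Polynomial.X ^ 2)
  -- This is the bound `t * (1 + 2 * (L + t))` of `Exec.bits_le` with `T` for the time and `L` the
  -- input bits plus those of the constants in the program.
  refine ⟨T * (1 + 2 * (Polynomial.X + Polynomial.C program.litSize + T)), fun h hk => ?_⟩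
  obtain ⟨t, b, ⟨s, hE, hs⟩, ht⟩ := exists_checksSer h
  refine ⟨t, b, ⟨s, hE, hs⟩, ?_⟩
  have hb := (hE.bits_le (bitLength h.encode + program.litSize)
    ((fits_ofInput _).mono (by omega)) (by omega)).2
  have hT : t ≤ T.eval (bitLength h.encode) := by
    have := Nat.mul_le_mul_left 3000 (steps_le hk)
    simp only [T, Polynomial.eval_mul, Polynomial.eval_add, Polynomial.eval_pow,
      Polynomial.eval_X, Polynomial.eval_ofNat]
    omega
  refine hb.trans ?_
  simp only [Polynomial.eval_mul, Polynomial.eval_add, Polynomial.eval_X, Polynomial.eval_C,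
    Polynomial.eval_ofNat, Polynomial.eval_one]
  exact Nat.mul_le_mul hT (by omega)
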